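/- Let $\mathbb K$ be a field, $\mathfrak g$ a Lie algebra over $\mathbb K$ and $n\ge 2$. A \emph{crossed module} $(V,L,\partial)$ consists of a Lie algebra $L$, an $L$-module $V$ and an $L$-module map $\partial:V\to L$ with $[\partial v,w]=-[\partial w,v]$ and $[\partial v,v]=0$ for all $v,w\in V$ (the second identity follows from the first if $\operatorname{char}\mathbb K\ne 2$). A \emph{crossed $n$-fold extension} of $\mathfrak g$ by a $\mathfrak g$-module $M$ is an exact sequence $$0\to M\xrightarrow{f} M_{n-1}\xrightarrow{\partial_{n-1}}\cdots\xrightarrow{\partial_2}M_1\xrightarrow{\partial_1}L\xrightarrow{\pi}\mathfrak g\to 0$$ in which $(M_1,L,\partial_1)$ is a crossed module, $\pi$ is a morphism of Lie algebras, $M_i$ is a $\mathfrak g$-module for $1<i\le n-1$, and $f$ and $\partial_i$ ($i>1$) are morphisms of $\mathfrak g$-modules (where $\ker\partial_1$ is a $\mathfrak g$-module via $[\pi(x),v]=[x,v]$). A morphism of two such extensions, by $M$ and by $\bar M$, is a commutative ladder $(\alpha,\delta_{n-1},\dots,\delta_1,\beta,\mathrm{id}_{\mathfrak g})$ with $\alpha$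 and $\delta_i$ ($i\ge2$) morphisms of $\mathfrak g$-modules, $\delta_1$ linear, $\beta$ a morphism of Lie algebras and $\delta_1[x,v]=[\beta(x),\delta_1(v)]$. $\mathrm{Opext}^n(\mathfrak g,M)$ is the set of crossed $n$-fold extensions of $\mathfrak g$ by $M$ modulo the equivalence relation generated by the morphisms with $\alpha=\mathrm{id}_M$. A $\mathfrak g$-module map $\alpha:M\to N$ induces $\alpha_*:\mathrm{Opext}^n(\mathfrak g,M)\to\mathrm{Opext}^n(\mathfrak g,N)$, which replaces $M\to M_{n-1}$ by its pushout along $\alpha$. The Baer sum of $\mathcal E$ and $\mathcal E'$ is $\nabla_*(\mathcal E\oplus_{\mathfrak g}\mathcal E')$, where $\nabla:M\oplus M\to M$ is addition and $\mathcal E\oplus_{\mathfrak g}\mathcal E'$ is the termwise direct sum over $\mathfrak g$, with $L\times_{\mathfrak g}L'$ in place of $L$. \textbf{Theorem.} For every $n\ge2$ and every $\mathfrak g$-module $M$, the Baer sum makes $\mathrm{Opext}^n(\mathfrak g,M)$ an abelian group, with zero the class of $0\to M=M\to 0\to\cdots\to0\to\mathfrak g=\mathfrak g\to0$ and with the inverse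 given by replacing $f$ by $-f$. Let $0\to M\xrightarrow{\alpha}M'\xrightarrow{\beta}M''\to0$ be a short exact sequence of $\mathfrak g$-modules, and for $n\ge2$ let $$\delta:\mathrm{Opext}^n(\mathfrak g,M'')\to\mathrm{Opext}^{n+1}(\mathfrak g,M)$$ send the class of $0\to M''\xrightarrow{f}M_{n-1}\to\cdots\to M_1\to L\to\mathfrak g\to0$ to the class of $0\to M\xrightarrow{\alpha}M'\xrightarrow{f\beta}M_{n-1}\to\cdots\to M_1\to L\to\mathfrak g\to0$. Then $\alpha_*$, $\beta_*$ and $\delta$ are homomorphisms, and the sequence $$\mathrm{Opext}^2(\mathfrak g,M)\xrightarrow{\alpha_*}\mathrm{Opext}^2(\mathfrak g,M')\xrightarrow{\beta_*}\mathrm{Opext}^2(\mathfrak g,M'')\xrightarrow{\delta}\mathrm{Opext}^3(\mathfrak g,M)\xrightarrow{\alpha_*}\mathrm{Opext}^3(\mathfrak g,M')\to\cdots$$ is exact at every term except possibly the first. -/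

import Mathlib

universe u

/-- A module over the Lie algebra `g`, bundled. -/
structure LieMod (K : Type u) (g : Type u) [Field K] [LieRing g] [LieAlgebra K g] where
  carrier : Type u
  [addCommGroup : AddCommGroup carrier]
  [module : Module K carrier]
  [lieRingModule : LieRingModule g carrier]
  [lieModule : LieModule K g carrier]

namespace LieMod

instance {K g : Type u} [Field K] [LieRing g] [LieAlgebra K g] :
    CoeSort (LieMod K g) (Type u) := ⟨LieMod.carrier⟩

attribute [instance] addCommGroup module lieRingModule lieModule

variable {K g L : Type u} [Field K] [LieRing g] [LieAlgebra K g] [LieRing L] [LieAlgebra K L]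

/-- The `g`-module `A` seen as an `L`-module along a morphism of Lie algebras `φ : L → g`:
`⁅x, a⁆ = ⁅φ x, a⁆`. -/
def comap (φ : L →ₗ⁅K⁆ g) (A : LieMod K g) : LieMod K L where
  carrier := A.carrier
  lieRingModule := LieRingModule.compLieHom A.carrier φ
  lieModule := LieModule.compLieHom A.carrier φ

/-- A morphism of `g`-modules is also one of `L`-modules. -/
def comapHom (φ : L →ₗ⁅K⁆ g) {A B : LieMod K g} (f : A →ₗ⁅K,g⁆ B) :
    A.comap φ →ₗ⁅K,L⁆ B.comap φ where
  toFun := f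
  map_add' := f.map_add
  map_smul' := f.map_smul
  map_lie' {x m} := f.map_lie (φ x) m

section

variable {A B : Type u} [AddCommGroup A] [Module K A] [LieRingModule g A] [LieModule K g A]
  [AddCommGroup B] [Module K B] [LieRingModule g B] [LieModule K g B]

/-- The coordinatewise action on a direct sum of modules. -/
instance prodLieRingModule : LieRingModule g (A × B) where
  bracket x m := (⁅x, m.1⁆, ⁅x, m.2⁆)
  add_lie x y m := Prod.ext (add_lie x y m.1) (add_lie x y m.2)
  lie_add x m n := Prod.ext (lie_add x m.1 n.1) (lie_add x m.2 n.2)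
  leibniz_lie x y m := Prod.ext (leibniz_lie x y m.1) (leibniz_lie x y m.2)

instance prodLieModule : LieModule K g (A × B) where
  smul_lie t x m := Prod.ext (smul_lie t x m.1) (smul_lie t x m.2)
  lie_smul t x m := Prod.ext (lie_smul t x m.1) (lie_smul t x m.2)

instance punitLieRingModule : LieRingModule g PUnit.{u + 1} where
  bracket _ _ := PUnit.unit
  add_lie _ _ _ := rfl
  lie_add _ _ _ := rfl
  leibniz_lie _ _ _ := rfl

instance punitLieModule : LieModule K g PUnit.{u + 1} where
  smul_lie _ _ _ := rfl
  lie_smul _ _ _ := rfl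

end

/-- The direct sum `A ⊕ B` of modules. -/
abbrev prod (A B : LieMod K g) : LieMod K g where
  carrier := A.carrier × B.carrier

/-- The zero module. -/
abbrev zero (K g : Type u) [Field K] [LieRing g] [LieAlgebra K g] : LieMod K g where
  carrier := PUnit.{u + 1}

/-- The direct sum of two morphisms of modules. -/
def prodMap {A B A' B' : LieMod K g} (f : A →ₗ⁅K,g⁆ B) (f' : A' →ₗ⁅K,g⁆ B') :
    A.prod A' →ₗ⁅K,g⁆ B.prod B' where
  toFun m := (f m.1, f' m.2)
  map_add' m n := Prod.ext (f.map_add m.1 n.1) (f'.map_add m.2 n.2)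
  map_smul' t m := Prod.ext (f.map_smul t m.1) (f'.map_smul t m.2)
  map_lie' {x m} := Prod.ext (f.map_lie x m.1) (f'.map_lie x m.2)

/-- The codiagonal map `A ⊕ A → A`, `(a, b) ↦ a + b`. -/
def codiag (A : LieMod K g) : A.prod A →ₗ⁅K,g⁆ A where
  toFun m := m.1 + m.2
  map_add' m n := add_add_add_comm m.1 n.1 m.2 n.2
  map_smul' t m := (smul_add t m.1 m.2).symm
  map_lie' {x m} := (lie_add x m.1 m.2).symm

section Pushout

variable {A B C : LieMod K g} (f : A →ₗ⁅K,g⁆ B) (h : A →ₗ⁅K,g⁆ C)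

/-- The submodule `{(f a, - h a)}` of `B ⊕ C`. -/
def pushoutRel : LieSubmodule K g (B.prod C) where
  carrier := Set.range fun a : A => ((f a, -h a) : B.prod C)
  zero_mem' := ⟨0, Prod.ext (f.map_zero) (by simp)⟩
  add_mem' := by
    rintro _ _ ⟨a, rfl⟩ ⟨b, rfl⟩
    refine ⟨a + b, Prod.ext (f.map_add a b) ?_⟩
    change -h (a + b) = -h a + -h b
    rw [map_add, neg_add]
  smul_mem' := by
    rintro t _ ⟨a, rfl⟩
    refine ⟨t • a, Prod.ext (f.map_smul t a) ?_⟩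
    change -h (t • a) = t • -h a
    rw [map_smul, smul_neg]
  lie_mem := by
    rintro x _ ⟨a, rfl⟩
    refine ⟨⁅x, a⁆, Prod.ext (f.map_lie x a) ?_⟩
    change -h ⁅x, a⁆ = ⁅x, -h a⁆
    rw [LieModuleHom.map_lie, lie_neg]

/-- The pushout `(B ⊕ C) / {(f a, - h a)}` of `f : A → B` and `h : A → C`. -/
def pushout : LieMod K g where
  carrier := (B.prod C) ⧸ pushoutRel f h

/-- The quotient map `B ⊕ C → pushout f h`. -/
def pushoutMk : B.prod C →ₗ⁅K,g⁆ pushout f h := LieSubmodule.Quotient.mk' (pushoutRel f h)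

/-- The canonical map `B → pushout f h`. -/
def pushoutInl : B →ₗ⁅K,g⁆ pushout f h where
  toFun b := pushoutMk f h (b, 0)
  map_add' b c := by
    rw [← map_add]; exact congrArg _ (Prod.ext rfl (add_zero _).symm)
  map_smul' t b := by
    rw [RingHom.id_apply, ← map_smul]; exact congrArg _ (Prod.ext rfl (smul_zero t).symm)
  map_lie' {x b} := by
    rw [← LieModuleHom.map_lie]; exact congrArg _ (Prod.ext rfl (lie_zero x).symm)

theorem pushoutMk_surjective : Function.Surjective (pushoutMk f h) :=
  LieSubmodule.Quotient.surjective_mk' _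

theorem pushoutMk_eq_zero {m : B.prod C} :
    pushoutMk f h m = 0 ↔ ∃ a : A, (f a, -h a) = m :=
  LieSubmodule.Quotient.mk_eq_zero _

theorem pushoutMk_congr {m n : B.prod C} (a : A) (h₁ : m.1 - n.1 = f a) (h₂ : m.2 - n.2 = -h a) :
    pushoutMk f h m = pushoutMk f h n := by
  rw [← sub_eq_zero, ← map_sub]
  exact (pushoutMk_eq_zero f h).2 ⟨a, Prod.ext h₁.symm h₂.symm⟩

variable {D : Type u} [AddCommGroup D] [Module K D] [LieRingModule g D]

/-- The map `pushout f h → D` induced by `i : B → D` and `j : C → D` with `i f = j h`. -/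
def pushoutDesc (i : B →ₗ⁅K,g⁆ D) (j : C →ₗ⁅K,g⁆ D) (hij : ∀ a, i (f a) = j (h a)) :
    pushout f h →ₗ⁅K,g⁆ D :=
  { (pushoutRel f h).toSubmodule.liftQ
      (i.toLinearMap.coprod j.toLinearMap) (by
        rintro _ ⟨a, rfl⟩
        change i (f a) + j (-h a) = 0
        rw [map_neg, hij, add_neg_cancel]) with
    map_lie' := by
      intro x m
      obtain ⟨m, rfl⟩ := pushoutMk_surjective f h m
      change i ⁅x, m.1⁆ + j ⁅x, m.2⁆ = ⁅x, i m.1 + j m.2⁆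
      rw [LieModuleHom.map_lie, LieModuleHom.map_lie, lie_add] }

@[simp] theorem pushoutDesc_mk (i : B →ₗ⁅K,g⁆ D) (j : C →ₗ⁅K,g⁆ D)
    (hij : ∀ a, i (f a) = j (h a)) (m : B.prod C) :
    pushoutDesc f h i j hij (pushoutMk f h m) = i m.1 + j m.2 := rfl

end Pushout

end LieMod

/-- A crossed module `(V, L, ∂)` of Lie algebras over `K`. The condition `alt` follows from `skew`
if `2` is invertible in `K`; in characteristic two it is the counterpart of the identity
`⁅x, x⁆ = 0` of a Lie algebra. -/
structure CrossedModule (K : Type u) [Field K] where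
  L : Type u
  [lieRing : LieRing L]
  [lieAlgebra : LieAlgebra K L]
  V : LieMod K L
  bd : V →ₗ⁅K,L⁆ L
  skew : ∀ v w : V, ⁅bd v, w⁆ = -⁅bd w, v⁆
  alt : ∀ v : V, ⁅bd v, v⁆ = 0

namespace CrossedModule

attribute [instance] lieRing lieAlgebra

variable {K : Type u} [Field K]

/-- A map of crossed modules: a linear map `V → V'` and a Lie algebra map `L → L'`, compatible with
the boundary maps and with the actions. -/
structure Hom (C C' : CrossedModule K) where
  onV : C.V →ₗ[K] C'.V
  onL : C.L →ₗ⁅K⁆ C'.L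
  comm : ∀ v, C'.bd (onV v) = onL (C.bd v)
  map_lie : ∀ (x : C.L) (v : C.V), onV ⁅x, v⁆ = ⁅onL x, onV v⁆

end CrossedModule

/-- A crossed module over `g`: a crossed module `∂ : V → L` with an identification
`π : L → g` of its cokernel with `g`. -/
structure CrossedModuleOver (K g : Type u) [Field K] [LieRing g] [LieAlgebra K g] extends
    CrossedModule K where
  proj : L →ₗ⁅K⁆ g
  proj_surjective : Function.Surjective proj
  exact_bd_proj : Function.Exact bd proj

namespace CrossedModuleOver

variable {K g : Type u} [Field K] [LieRing g] [LieAlgebra K g]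

/-- The fibre product `L ×_g L'`, a Lie subalgebra of `L × L'`. -/
def fibre (C C' : CrossedModuleOver K g) : LieSubalgebra K (C.L × C'.L) where
  carrier := {x | C.proj x.1 = C'.proj x.2}
  zero_mem' := by simp
  add_mem' := by
    intro x y hx hy
    change C.proj x.1 = C'.proj x.2 at hx
    change C.proj y.1 = C'.proj y.2 at hy
    change C.proj (x.1 + y.1) = C'.proj (x.2 + y.2)
    simp [hx, hy]
  smul_mem' := by
    intro t x hx
    change C.proj x.1 = C'.proj x.2 at hx
    change C.proj (t • x.1) = C'.proj (t • x.2)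
    simp [hx]
  lie_mem' := by
    intro x y hx hy
    change C.proj x.1 = C'.proj x.2 at hx
    change C.proj y.1 = C'.proj y.2 at hy
    change C.proj ⁅x.1, y.1⁆ = C'.proj ⁅x.2, y.2⁆
    simp [hx, hy]

/-- The first projection of the fibre product. -/
def fibreFst (C C' : CrossedModuleOver K g) : fibre C C' →ₗ⁅K⁆ C.L :=
  (LieHom.fst K C.L C'.L).comp (fibre C C').incl

/-- The second projection of the fibre product. -/
def fibreSnd (C C' : CrossedModuleOver K g) : fibre C C' →ₗ⁅K⁆ C'.L :=
  (LieHom.snd K C.L C'.L).comp (fibre C C').incl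

/-- The sum over `g` of two crossed modules: `V ⊕ V' → L ×_g L'`, with coordinatewise action. -/
def sum (C C' : CrossedModuleOver K g) : CrossedModuleOver K g where
  L := fibre C C'
  V := (C.V.comap (fibreFst C C')).prod (C'.V.comap (fibreSnd C C'))
  bd :=
    { toFun := fun v => ⟨(C.bd v.1, C'.bd v.2), 
        (C.exact_bd_proj.apply_apply_eq_zero v.1).trans
          (C'.exact_bd_proj.apply_apply_eq_zero v.2).symm⟩
      map_add' := fun v w => Subtype.ext (Prod.ext (C.bd.map_add v.1 w.1) (C'.bd.map_add v.2 w.2))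
      map_smul' := fun t v => Subtype.ext (Prod.ext (C.bd.map_smul t v.1) (C'.bd.map_smul t v.2))
      map_lie' := fun {x v} => Subtype.ext (Prod.ext
        (C.bd.map_lie (fibreFst C C' x) v.1) (C'.bd.map_lie (fibreSnd C C' x) v.2)) }
  skew v w := Prod.ext (C.skew v.1 w.1) (C'.skew v.2 w.2)
  alt v := Prod.ext (C.alt v.1) (C'.alt v.2)
  proj := C.proj.comp (fibreFst C C')
  proj_surjective z := by
    obtain ⟨x, hx⟩ := C.proj_surjective z
    obtain ⟨y, hy⟩ := C'.proj_surjective z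
    exact ⟨⟨(x, y), hx.trans hy.symm⟩, hx⟩
  exact_bd_proj := by
    rintro ⟨⟨x, y⟩, hxy⟩
    change C.proj x = C'.proj y at hxy
    constructor
    · intro hx
      change C.proj x = 0 at hx
      obtain ⟨v, hv⟩ := (C.exact_bd_proj x).1 hx
      obtain ⟨w, hw⟩ := (C'.exact_bd_proj y).1 (hxy ▸ hx)
      exact ⟨(v, w), Subtype.ext (Prod.ext hv hw)⟩
    · rintro ⟨v, hv⟩
      have h1 : C.bd v.1 = x := congrArg (fun z => z.1.1) hv
      change C.proj x = 0
      rw [← h1]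
      exact C.exact_bd_proj.apply_apply_eq_zero _

theorem push_aux (C : CrossedModuleOver K g) {A B : LieMod K g} (α : A →ₗ⁅K,g⁆ B)
    (ι : A.comap C.proj →ₗ⁅K,C.L⁆ C.V) (v : C.V) (c : B.comap C.proj) (w : C.V) :
    LieMod.pushoutMk (LieMod.comapHom C.proj α) ι
        (⁅(0 : C.L) + C.bd v, c⁆, ⁅(0 : C.L) + C.bd v, w⁆) =
      LieMod.pushoutMk _ _ (0, ⁅C.bd v, w⁆) := by
  rw [zero_add]
  refine congrArg _ (Prod.ext ?_ rfl)
  have h := C.exact_bd_proj.apply_apply_eq_zero v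
  exact (congrArg (fun z => (⁅z, (c : B.carrier)⁆ : B.carrier)) h).trans
    (zero_lie (L := g) (M := B.carrier) c)

/-- For a crossed module `∂ : V → L` over `g`, a map `ι : A → V` with `∂ ι = 0` and `α : A → B`,
the crossed module whose first term is the pushout of `B` and `V`, with the boundary map induced by
zero on `B` and by `∂` on `V`. -/
def push (C : CrossedModuleOver K g) {A B : LieMod K g} (α : A →ₗ⁅K,g⁆ B)
    (ι : A.comap C.proj →ₗ⁅K,C.L⁆ C.V) (hι : ∀ a, C.bd (ι a) = 0) : CrossedModuleOver K g where
  L := C.L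
  V := LieMod.pushout (LieMod.comapHom C.proj α) ι
  bd := LieMod.pushoutDesc (LieMod.comapHom C.proj α) ι 0 C.bd (fun a => (hι a).symm)
  skew v w := by
    obtain ⟨⟨b, v⟩, rfl⟩ := LieMod.pushoutMk_surjective _ _ v
    obtain ⟨⟨c, w⟩, rfl⟩ := LieMod.pushoutMk_surjective _ _ w
    refine (push_aux C α ι v c w).trans ?_
    refine Eq.trans ?_ (congrArg Neg.neg (push_aux C α ι w b v).symm)
    rw [C.skew v w, ← map_neg]
    exact congrArg _ (Prod.ext neg_zero.symm rfl)
  alt v := by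
    obtain ⟨⟨b, v⟩, rfl⟩ := LieMod.pushoutMk_surjective _ _ v
    refine (push_aux C α ι v b v).trans ?_
    rw [C.alt v]
    exact map_zero (LieMod.pushoutMk _ _)
  proj := C.proj
  proj_surjective := C.proj_surjective
  exact_bd_proj x := by
    rw [C.exact_bd_proj x]
    constructor
    · rintro ⟨v, rfl⟩
      exact ⟨LieMod.pushoutMk _ _ (0, v), zero_add (C.bd v)⟩
    · rintro ⟨m, rfl⟩
      obtain ⟨⟨b, v⟩, rfl⟩ := LieMod.pushoutMk_surjective _ _ m
      exact ⟨v, (zero_add (C.bd v)).symm⟩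

/-- The crossed module `0 : W → g` for a `g`-module `W`. -/
def trivial (W : LieMod K g) : CrossedModuleOver K g where
  L := g
  V := W
  bd := 0
  skew v w := by simp
  alt v := by simp
  proj := LieHom.id
  proj_surjective z := ⟨z, rfl⟩
  exact_bd_proj z := by
    constructor
    · intro hz
      exact ⟨0, by simpa using hz.symm⟩
    · rintro ⟨v, rfl⟩
      rfl

end CrossedModuleOver

/-- A sequence `A → M_{k+1} → ⋯ → M_2 → M_1 → L → g` whose part `∂₁ : M_1 → L` is a
crossed module over `g`, where `A, M_{k+1}, …, M_2` are `g`-modules, and where all the maps up to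
the one into `M_1` are morphisms of `g`-modules. For the map `ι` into the `L`-module `M_1` this
means `ι ⁅π x, a⁆ = ⁅x, ι a⁆` for `x ∈ L`. Exactness is imposed below. -/
inductive CrossedSeq (K g : Type u) [Field K] [LieRing g] [LieAlgebra K g] :
    ℕ → LieMod K g → Type (u + 1)
  | crossed {A : LieMod K g} (C : CrossedModuleOver K g) (ι : A.comap C.proj →ₗ⁅K,C.L⁆ C.V) :
      CrossedSeq K g 0 A
  | cons {k : ℕ} {A : LieMod K g} (X : LieMod K g) (f : A →ₗ⁅K,g⁆ X)
      (S : CrossedSeq K g k X) : CrossedSeq K g (k + 1) A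

namespace CrossedSeq

variable {K g : Type u} [Field K] [LieRing g] [LieAlgebra K g]

/-- The kernel of the leftmost map of the sequence. -/
def firstKer : {k : ℕ} → {A : LieMod K g} → CrossedSeq K g k A → Submodule K A
  | _, A, crossed _ ι => (LinearMap.ker ι.toLinearMap : Submodule K A.carrier)
  | _, _, cons _ f _ => LinearMap.ker f.toLinearMap

/-- The sequence is exact at all its terms, except possibly at the leftmost one. -/
def IsExact : {k : ℕ} → {A : LieMod K g} → CrossedSeq K g k A → Prop
  | _, _, crossed C ι => Function.Exact ι C.bd
  | _, _, cons _ f S => LinearMap.range f.toLinearMap = S.firstKer ∧ S.IsExact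

/-- There is a morphism of sequences over `α : A → A'`: maps `α, δ_{k+1}, …, δ_1, β`, all squares
commuting, where `δ_i` for `i ≥ 2` is a morphism of `g`-modules and `(δ_1, β)` is a map of crossed
modules that induces the identity on `g`. -/
def MorOver : {k : ℕ} → {A A' : LieMod K g} → (A →ₗ⁅K,g⁆ A') →
    CrossedSeq K g k A → CrossedSeq K g k A' → Prop
  | _, _, _, α, crossed C ι, crossed C' ι' =>
      ∃ φ : CrossedModule.Hom C.toCrossedModule C'.toCrossedModule,
        (∀ x, C'.proj (φ.onL x) = C.proj x) ∧ ∀ a, φ.onV (ι a) = ι' (α a)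
  | _, _, _, α, cons X f S, cons X' f' S' =>
      ∃ φ : X →ₗ⁅K,g⁆ X', (∀ a, φ (f a) = f' (α a)) ∧ MorOver φ S S'

/-- Replace the leftmost map by its composite with `γ : B → A`. -/
def precomp {A B : LieMod K g} (γ : B →ₗ⁅K,g⁆ A) :
    {k : ℕ} → CrossedSeq K g k A → CrossedSeq K g k B
  | _, crossed C ι => crossed C (ι.comp (LieMod.comapHom C.proj γ))
  | _, cons X f S => cons X (f.comp γ) S

/-- For `B ← A → X` and a sequence starting from `X` whose first map kills the image of `A`, the
sequence starting from the pushout of `B` and `X`, whose first map is induced by zero on `B` and by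
the given one on `X`. -/
def descend {A B X : LieMod K g} (α : A →ₗ⁅K,g⁆ B) (f : A →ₗ⁅K,g⁆ X) :
    {k : ℕ} → (S : CrossedSeq K g k X) → (∀ a, f a ∈ S.firstKer) →
      CrossedSeq K g k (LieMod.pushout α f)
  | _, crossed C ι, h => crossed C
      { LieMod.pushoutDesc (LieMod.comapHom C.proj α) (LieMod.comapHom C.proj f) 0 ι
          (fun a => (LinearMap.mem_ker.1 (h a)).symm) with
        map_lie' := fun {x m} => by
          exact (LieMod.pushoutDesc (LieMod.comapHom C.proj α) (LieMod.comapHom C.proj f) 0 ι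
            (fun a => (LinearMap.mem_ker.1 (h a)).symm)).map_lie x m }
  | _, cons Y f' S, h => cons Y (LieMod.pushoutDesc α f 0 f' (fun a => (LinearMap.mem_ker.1 (h a)).symm)) S

/-- The sequence with `M_{k+1}` replaced by its pushout along `α : A → B` (`M_1` if `k = 0`). -/
def pushforward {A B : LieMod K g} (α : A →ₗ⁅K,g⁆ B) :
    {k : ℕ} → (S : CrossedSeq K g k A) → S.IsExact → CrossedSeq K g k B
  | _, crossed C ι, h =>
      crossed (C.push α ι h.apply_apply_eq_zero) (LieMod.pushoutInl (LieMod.comapHom C.proj α) ι)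
  | _, cons _ f S, h =>
      cons (LieMod.pushout α f) (LieMod.pushoutInl α f)
        (S.descend α f fun a => h.1 ▸ LinearMap.mem_range_self f.toLinearMap a)

/-- The sum of two sequences over `g`:
`A ⊕ A' → M_{k+1} ⊕ M'_{k+1} → ⋯ → M_1 ⊕ M'_1 → L ×_g L' → g`. -/
def sum : {k : ℕ} → {A A' : LieMod K g} → CrossedSeq K g k A → CrossedSeq K g k A' →
    CrossedSeq K g k (A.prod A')
  | _, _, _, crossed C ι, crossed C' ι' => crossed (C.sum C')
      { toFun := fun a => (ι a.1, ι' a.2)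
        map_add' := fun a b => Prod.ext (ι.map_add a.1 b.1) (ι'.map_add a.2 b.2)
        map_smul' := fun t a => Prod.ext (ι.map_smul t a.1) (ι'.map_smul t a.2)
        map_lie' := fun {x a} => Prod.ext (ι.map_lie x.1.1 a.1) (by
          refine Eq.trans ?_ (ι'.map_lie x.1.2 a.2)
          refine congrArg ι' ?_
          change ⁅C.proj x.1.1, a.2⁆ = ⁅C'.proj x.1.2, a.2⁆
          rw [show C.proj x.1.1 = C'.proj x.1.2 from x.2]) }
  | _, _, _, cons X f S, cons X' f' S' => cons (X.prod X') (LieMod.prodMap f f') (S.sum S')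

/-- The sequence `A → 0 → ⋯ → 0 → g → g`. -/
def null : (k : ℕ) → (A : LieMod K g) → CrossedSeq K g k A
  | 0, _ => crossed (CrossedModuleOver.trivial (LieMod.zero K g)) 0
  | k + 1, _ => cons (LieMod.zero K g) 0 (null k (LieMod.zero K g))

/-- The sequence `A = A → 0 → ⋯ → 0 → g = g`. -/
def zero : (k : ℕ) → (A : LieMod K g) → CrossedSeq K g k A
  | 0, A => crossed (CrossedModuleOver.trivial A)
      { toFun := fun a => a
        map_add' := fun _ _ => rfl
        map_smul' := fun _ _ => rfl
        map_lie' := rfl }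
  | k + 1, A => cons A LieModuleHom.id (null k A)

/-! ### Exactness and morphisms of the constructed sequences -/

theorem firstKer_precomp {A B : LieMod K g} (γ : B →ₗ⁅K,g⁆ A) {k : ℕ} (S : CrossedSeq K g k A) :
    (S.precomp γ).firstKer = S.firstKer.comap γ.toLinearMap := by
  cases S <;> rfl

theorem IsExact.precomp {A B : LieMod K g} {γ : B →ₗ⁅K,g⁆ A} (hγ : Function.Surjective γ)
    {k : ℕ} {S : CrossedSeq K g k A} (h : S.IsExact) : (S.precomp γ).IsExact := by
  cases S with
  | crossed C ι =>
    intro v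
    refine (h v).trans ⟨?_, ?_⟩
    · rintro ⟨a, rfl⟩
      obtain ⟨b, rfl⟩ := hγ a
      exact ⟨b, rfl⟩
    · rintro ⟨b, rfl⟩
      exact ⟨γ b, rfl⟩
  | cons X f S =>
    refine ⟨?_, h.2⟩
    rw [← h.1]
    ext x
    constructor
    · rintro ⟨b, rfl⟩
      exact ⟨γ b, rfl⟩
    · rintro ⟨a, rfl⟩
      obtain ⟨b, rfl⟩ := hγ a
      exact ⟨b, rfl⟩

theorem mem_firstKer_descend {A B X : LieMod K g} (α : A →ₗ⁅K,g⁆ B) (f : A →ₗ⁅K,g⁆ X) {k : ℕ}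
    (S : CrossedSeq K g k X) (h : ∀ a, f a ∈ S.firstKer) (b : B) (x : X) :
    LieMod.pushoutMk α f (b, x) ∈ (S.descend α f h).firstKer ↔ x ∈ S.firstKer := by
  cases S with
  | crossed C ι =>
    change 0 + ι x = 0 ↔ ι x = 0
    rw [zero_add]
  | cons Y f' S =>
    change 0 + f' x = 0 ↔ f' x = 0
    rw [zero_add]

theorem IsExact.descend {A B X : LieMod K g} (α : A →ₗ⁅K,g⁆ B) (f : A →ₗ⁅K,g⁆ X) {k : ℕ}
    {S : CrossedSeq K g k X} (h : ∀ a, f a ∈ S.firstKer) (hS : S.IsExact) :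
    (S.descend α f h).IsExact := by
  cases S with
  | crossed C ι =>
    intro v
    refine (hS v).trans ⟨?_, ?_⟩
    · rintro ⟨x, rfl⟩
      exact ⟨LieMod.pushoutMk α f (0, x), zero_add (ι x)⟩
    · rintro ⟨m, rfl⟩
      obtain ⟨⟨b, x⟩, rfl⟩ := LieMod.pushoutMk_surjective _ _ m
      exact ⟨x, (zero_add (ι x)).symm⟩
  | cons Y f' S =>
    refine ⟨?_, hS.2⟩
    rw [← hS.1]
    ext y
    constructor
    · rintro ⟨m, rfl⟩
      obtain ⟨⟨b, x⟩, rfl⟩ := LieMod.pushoutMk_surjective _ _ m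
      exact ⟨x, (zero_add (f' x)).symm⟩
    · rintro ⟨x, rfl⟩
      exact ⟨LieMod.pushoutMk α f (0, x), zero_add (f' x)⟩

theorem IsExact.pushforward {A B : LieMod K g} (α : A →ₗ⁅K,g⁆ B) {k : ℕ}
    {S : CrossedSeq K g k A} (h : S.IsExact) : (S.pushforward α h).IsExact := by
  cases S with
  | crossed C ι =>
    intro m
    obtain ⟨⟨b, v⟩, rfl⟩ := LieMod.pushoutMk_surjective _ _ m
    constructor
    · intro hm
      have hv : C.bd v = 0 := (zero_add (C.bd v)).symm.trans hm
      obtain ⟨a, rfl⟩ := (h v).1 hv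
      refine ⟨b + LieMod.comapHom C.proj α a, LieMod.pushoutMk_congr _ _ a ?_ (zero_sub (ι a))⟩
      exact add_sub_cancel_left b (LieMod.comapHom C.proj α a)
    · rintro ⟨c, hc⟩
      rw [← hc]
      change 0 + C.bd 0 = 0
      rw [map_zero, zero_add]
  | cons X f S =>
    refine ⟨?_, h.2.descend α f _⟩
    ext m
    obtain ⟨⟨b, x⟩, rfl⟩ := LieMod.pushoutMk_surjective _ _ m
    rw [mem_firstKer_descend, ← h.1]
    constructor
    · rintro ⟨c, hc⟩
      have : LieMod.pushoutMk α f ((c, 0) - (b, x)) = 0 := by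
        rw [map_sub]; exact sub_eq_zero.2 hc
      obtain ⟨a, ha⟩ := (LieMod.pushoutMk_eq_zero α f).1 this
      refine ⟨a, ?_⟩
      have h2 : -f a = 0 - x := congrArg Prod.snd ha
      rw [zero_sub, neg_inj] at h2
      exact h2
    · rintro ⟨a, rfl⟩
      exact ⟨b + α a, LieMod.pushoutMk_congr α f a (add_sub_cancel_left b (α a))
        (zero_sub (f a))⟩

theorem firstKer_pushforward {A B : LieMod K g} (α : A →ₗ⁅K,g⁆ B) {k : ℕ}
    {S : CrossedSeq K g k A} (h : S.IsExact) (h₀ : S.firstKer = ⊥) :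
    (S.pushforward α h).firstKer = ⊥ := by
  rw [eq_bot_iff]
  cases S with
  | crossed C ι =>
    intro b hb
    obtain ⟨a, ha⟩ := (LieMod.pushoutMk_eq_zero (LieMod.comapHom C.proj α) ι).1 hb
    have h2 : -ι a = 0 := congrArg Prod.snd ha
    have h1 : α a = b := congrArg Prod.fst ha
    have h3 : a ∈ (crossed C ι).firstKer := neg_eq_zero.1 h2
    rw [h₀] at h3
    have h4 : a = 0 := h3
    rw [← h1, h4]
    exact α.map_zero
  | cons X f S =>
    intro b hb
    obtain ⟨a, ha⟩ := (LieMod.pushoutMk_eq_zero α f).1 hb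
    have h2 : -f a = 0 := congrArg Prod.snd ha
    have h1 : α a = b := congrArg Prod.fst ha
    have h3 : a ∈ (cons X f S).firstKer := neg_eq_zero.1 h2
    rw [h₀] at h3
    rw [← h1, (Submodule.mem_bot K).1 h3, map_zero]
    exact Submodule.zero_mem _

theorem mem_firstKer_sum {k : ℕ} {A A' : LieMod K g} (S : CrossedSeq K g k A)
    (S' : CrossedSeq K g k A') (a : A) (a' : A') :
    ((a, a') : A.prod A') ∈ (S.sum S').firstKer ↔ a ∈ S.firstKer ∧ a' ∈ S'.firstKer := by
  cases S with
  | crossed C ι => cases S' with | crossed C' ι' => exact Prod.mk_eq_zero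
  | cons X f S => cases S' with | cons X' f' S' => exact Prod.mk_eq_zero

theorem IsExact.sum {k : ℕ} {A A' : LieMod K g} {S : CrossedSeq K g k A}
    {S' : CrossedSeq K g k A'} (h : S.IsExact) (h' : S'.IsExact) : (S.sum S').IsExact := by
  induction S generalizing A' with
  | crossed C ι =>
    cases S' with
    | crossed C' ι' =>
      rintro ⟨v, v'⟩
      constructor
      · intro hv
        obtain ⟨a, ha⟩ := (h v).1 (congrArg (fun z => z.1.1) hv)
        obtain ⟨a', ha'⟩ := (h' v').1 (congrArg (fun z => z.1.2) hv)
        exact ⟨(a, a'), Prod.ext ha ha'⟩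
      · rintro ⟨a, ha⟩
        have h1 : ι a.1 = v := congrArg Prod.fst ha
        have h2 : ι' a.2 = v' := congrArg Prod.snd ha
        refine Subtype.ext (Prod.ext ?_ ?_)
        · exact (congrArg C.bd h1).symm.trans (h.apply_apply_eq_zero a.1)
        · exact (congrArg C'.bd h2).symm.trans (h'.apply_apply_eq_zero a.2)
  | cons X f S ih =>
    cases S' with
    | cons X' f' S' =>
      refine ⟨?_, ih h.2 h'.2⟩
      ext ⟨x, x'⟩
      rw [mem_firstKer_sum, ← h.1, ← h'.1]
      constructor
      · rintro ⟨a, ha⟩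
        exact ⟨⟨a.1, congrArg Prod.fst ha⟩, ⟨a.2, congrArg Prod.snd ha⟩⟩
      · rintro ⟨⟨a, ha⟩, ⟨a', ha'⟩⟩
        exact ⟨(a, a'), Prod.ext ha ha'⟩

theorem firstKer_null {k : ℕ} {A : LieMod K g} : (null k A).firstKer = ⊤ := by
  cases k <;> exact LinearMap.ker_zero

theorem isExact_null {k : ℕ} {A : LieMod K g} : (null k A).IsExact := by
  induction k generalizing A with
  | zero => exact fun v => ⟨fun _ => ⟨0, rfl⟩, fun _ => rfl⟩
  | succ k ih =>
    refine ⟨?_, ih⟩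
    rw [firstKer_null, eq_top_iff]
    exact fun x _ => ⟨0, rfl⟩

theorem isExact_zero {k : ℕ} {A : LieMod K g} : (zero k A).IsExact := by
  cases k with
  | zero => exact fun v => ⟨fun _ => ⟨v, rfl⟩, fun _ => rfl⟩
  | succ k =>
    refine ⟨?_, isExact_null⟩
    rw [firstKer_null, eq_top_iff]
    exact fun x _ => ⟨x, rfl⟩

theorem firstKer_zero {k : ℕ} {A : LieMod K g} : (zero k A).firstKer = ⊥ := by
  cases k <;> exact LinearMap.ker_id

theorem MorOver.refl {k : ℕ} {A : LieMod K g} (S : CrossedSeq K g k A) :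
    MorOver LieModuleHom.id S S := by
  induction S with
  | crossed C ι => exact ⟨⟨LinearMap.id, LieHom.id, fun _ => rfl, fun _ _ => rfl⟩,
      fun _ => rfl, fun _ => rfl⟩
  | cons X f S ih => exact ⟨LieModuleHom.id, fun _ => rfl, ih⟩

theorem MorOver.precomp {A A' B B' : LieMod K g} {γ : B →ₗ⁅K,g⁆ A} {γ' : B' →ₗ⁅K,g⁆ A'}
    {α : A →ₗ⁅K,g⁆ A'} {β : B →ₗ⁅K,g⁆ B'} (hc : ∀ b, α (γ b) = γ' (β b)) {k : ℕ}
    {S : CrossedSeq K g k A} {S' : CrossedSeq K g k A'} (h : MorOver α S S') :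
    MorOver β (S.precomp γ) (S'.precomp γ') := by
  cases S with
  | crossed C ι =>
    cases S' with
    | crossed C' ι' =>
      obtain ⟨φ, h1, h2⟩ := h
      exact ⟨φ, h1, fun b => (h2 (γ b)).trans (congrArg ι' (hc b))⟩
  | cons X f S =>
    cases S' with
    | cons X' f' S' =>
      obtain ⟨φ, h1, h2⟩ := h
      exact ⟨φ, fun b => (h1 (γ b)).trans (congrArg f' (hc b)), h2⟩

theorem MorOver.sum {k : ℕ} {A A' B B' : LieMod K g} {α : A →ₗ⁅K,g⁆ A'} {β : B →ₗ⁅K,g⁆ B'}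
    {S : CrossedSeq K g k A} {S' : CrossedSeq K g k A'} {T : CrossedSeq K g k B}
    {T' : CrossedSeq K g k B'} (h : MorOver α S S') (h' : MorOver β T T') :
    MorOver (LieMod.prodMap α β) (S.sum T) (S'.sum T') := by
  induction S generalizing A' B B' with
  | crossed C ι =>
    cases S' with
    | crossed C' ι' =>
    cases T with
    | crossed D κ =>
    cases T' with
    | crossed D' κ' =>
      obtain ⟨φ, h1, h2⟩ := h
      obtain ⟨ψ, h3, h4⟩ := h'
      refine ⟨⟨φ.onV.prodMap ψ.onV,
        { toFun := fun x => ⟨(φ.onL x.1.1, ψ.onL x.1.2),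
            (h1 x.1.1).trans (Eq.trans x.2 (h3 x.1.2).symm)⟩
          map_add' := fun x y => Subtype.ext (Prod.ext (φ.onL.map_add x.1.1 y.1.1)
            (ψ.onL.map_add x.1.2 y.1.2))
          map_smul' := fun t x => Subtype.ext (Prod.ext (φ.onL.map_smul t x.1.1)
            (ψ.onL.map_smul t x.1.2))
          map_lie' := fun {x y} => Subtype.ext (Prod.ext (φ.onL.map_lie x.1.1 y.1.1)
            (ψ.onL.map_lie x.1.2 y.1.2)) },
        fun v => Subtype.ext (Prod.ext (φ.comm v.1) (ψ.comm v.2)),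
        fun x v => Prod.ext (φ.map_lie x.1.1 v.1) (ψ.map_lie x.1.2 v.2)⟩,
        fun x => h1 x.1.1, fun a => Prod.ext (h2 a.1) (h4 a.2)⟩
  | cons X f S ih =>
    cases S' with
    | cons X' f' S' =>
    cases T with
    | cons Y e T =>
    cases T' with
    | cons Y' e' T' =>
      obtain ⟨φ, h1, h2⟩ := h
      obtain ⟨ψ, h3, h4⟩ := h'
      exact ⟨LieMod.prodMap φ ψ, fun a => Prod.ext (h1 a.1) (h3 a.2), ih h2 h4⟩

theorem MorOver.descend {A B X A' B' X' : LieMod K g} {α : A →ₗ⁅K,g⁆ B} {f : A →ₗ⁅K,g⁆ X}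
    {α' : A' →ₗ⁅K,g⁆ B'} {f' : A' →ₗ⁅K,g⁆ X'} {φ : X →ₗ⁅K,g⁆ X'} {β : B →ₗ⁅K,g⁆ B'}
    {ψ : LieMod.pushout α f →ₗ⁅K,g⁆ LieMod.pushout α' f'}
    (hψ : ∀ b x, ψ (LieMod.pushoutMk α f (b, x)) = LieMod.pushoutMk α' f' (β b, φ x))
    {k : ℕ} {S : CrossedSeq K g k X} {S' : CrossedSeq K g k X'} (hS : ∀ a, f a ∈ S.firstKer)
    (hS' : ∀ a, f' a ∈ S'.firstKer) (h : MorOver φ S S') :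
    MorOver ψ (S.descend α f hS) (S'.descend α' f' hS') := by
  cases S with
  | crossed C ι =>
    cases S' with
    | crossed C' ι' =>
      obtain ⟨χ, h1, h2⟩ := h
      refine ⟨χ, h1, fun m => ?_⟩
      obtain ⟨⟨b, x⟩, rfl⟩ := LieMod.pushoutMk_surjective α f m
      rw [hψ]
      change χ.onV (0 + ι x) = 0 + ι' (φ x)
      rw [zero_add, zero_add]
      exact h2 x
  | cons Y e S =>
    cases S' with
    | cons Y' e' S' =>
      obtain ⟨χ, h1, h2⟩ := h
      refine ⟨χ, fun m => ?_, h2⟩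
      obtain ⟨⟨b, x⟩, rfl⟩ := LieMod.pushoutMk_surjective α f m
      rw [hψ]
      change χ (0 + e x) = 0 + e' (φ x)
      rw [zero_add, zero_add, h1]

theorem MorOver.pushforward {A B A' B' : LieMod K g} {α : A →ₗ⁅K,g⁆ B} {α' : A' →ₗ⁅K,g⁆ B'}
    {γ : A →ₗ⁅K,g⁆ A'} {β : B →ₗ⁅K,g⁆ B'} (hc : ∀ a, β (α a) = α' (γ a)) {k : ℕ}
    {S : CrossedSeq K g k A} {S' : CrossedSeq K g k A'} (hS : S.IsExact) (hS' : S'.IsExact)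
    (h : MorOver γ S S') : MorOver β (S.pushforward α hS) (S'.pushforward α' hS') := by
  cases S with
  | crossed C ι =>
    cases S' with
    | crossed C' ι' =>
      obtain ⟨φ, h1, h2⟩ := h
      let i := LieMod.comapHom C.proj α
      let i' := LieMod.comapHom C'.proj α'
      let ψ : LieMod.pushout i ι →ₗ[K] LieMod.pushout i' ι' :=
        (LieMod.pushoutRel i ι).toSubmodule.mapQ (LieMod.pushoutRel i' ι').toSubmodule
          (β.toLinearMap.prodMap φ.onV) (by
            rintro _ ⟨a, rfl⟩
            refine ⟨γ a, Prod.ext (hc a).symm ?_⟩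
            change -ι' (γ a) = φ.onV (-ι a)
            rw [map_neg, h2])
      refine ⟨⟨ψ, φ.onL, fun m => ?_, fun x m => ?_⟩, h1, fun b => ?_⟩
      · obtain ⟨⟨b, v⟩, rfl⟩ := LieMod.pushoutMk_surjective i ι m
        change 0 + C'.bd (φ.onV v) = φ.onL (0 + C.bd v)
        rw [zero_add, zero_add, φ.comm]
      · obtain ⟨⟨b, v⟩, rfl⟩ := LieMod.pushoutMk_surjective i ι m
        refine congrArg (LieMod.pushoutMk i' ι') (Prod.ext ?_ (φ.map_lie x v))
        refine (β.map_lie (C.proj x) b).trans ?_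
        exact congrArg (fun z => ⁅z, β b⁆) (h1 x).symm
      · change LieMod.pushoutMk i' ι' (β b, φ.onV 0) = LieMod.pushoutMk i' ι' (β b, 0)
        rw [map_zero]
  | cons X f S =>
    cases S' with
    | cons X' f' S' =>
      obtain ⟨φ, h1, h2⟩ := h
      let ψ : LieMod.pushout α f →ₗ⁅K,g⁆ LieMod.pushout α' f' :=
        LieMod.pushoutDesc α f ((LieMod.pushoutMk α' f').comp (LieMod.prodMap β φ) |>.comp
            { toFun := fun b => (b, 0)
              map_add' := fun b c => Prod.ext rfl (add_zero _).symm
              map_smul' := fun t b => Prod.ext rfl (smul_zero t).symm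
              map_lie' := fun {x b} => Prod.ext rfl (lie_zero x).symm })
          ((LieMod.pushoutMk α' f').comp (LieMod.prodMap β φ) |>.comp
            { toFun := fun x => (0, x)
              map_add' := fun b c => Prod.ext (add_zero _).symm rfl
              map_smul' := fun t b => Prod.ext (smul_zero t).symm rfl
              map_lie' := fun {x b} => Prod.ext (lie_zero x).symm rfl })
          (fun a => LieMod.pushoutMk_congr α' f' (γ a)
            (by change β (α a) - β 0 = _; rw [map_zero, sub_zero, hc])
            (by change φ 0 - φ (f a) = _; rw [map_zero, zero_sub, h1]))
      have hψ : ∀ b x, ψ (LieMod.pushoutMk α f (b, x)) = LieMod.pushoutMk α' f' (β b, φ x) := by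
        intro b x
        change LieMod.pushoutMk α' f' (β b, φ 0) + LieMod.pushoutMk α' f' (β 0, φ x) = _
        rw [← map_add]
        refine congrArg _ (Prod.ext ?_ ?_)
        · change β b + β 0 = β b
          rw [map_zero, add_zero]
        · change φ 0 + φ x = φ x
          rw [map_zero, zero_add]
      refine ⟨ψ, fun b => (hψ b 0).trans ?_, h2.descend hψ _ _⟩
      rw [map_zero]
      rfl

end CrossedSeq

/-- A crossed `(k + 2)`-fold extension of `g` by `M`: an exact sequence
`0 → M → M_{k+1} → ⋯ → M_2 → M_1 → L → g → 0` as above. -/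
structure CrossedExt (K g : Type u) [Field K] [LieRing g] [LieAlgebra K g] (k : ℕ)
    (M : LieMod K g) where
  seq : CrossedSeq K g k M
  firstKer_eq_bot : seq.firstKer = ⊥
  isExact : seq.IsExact

namespace CrossedExt

variable {K g : Type u} [Field K] [LieRing g] [LieAlgebra K g] {k : ℕ}

/-- There is a morphism of crossed extensions that is the identity on `M` (and on `g`). -/
def Rel {M : LieMod K g} (E E' : CrossedExt K g k M) : Prop :=
  CrossedSeq.MorOver LieModuleHom.id E.seq E'.seq

/-- The extension `α E` of `g` by `M'`, for an extension `E` by `M` and `α : M → M'`. -/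
def pushforward {M M' : LieMod K g} (α : M →ₗ⁅K,g⁆ M') (E : CrossedExt K g k M) :
    CrossedExt K g k M' where
  seq := E.seq.pushforward α E.isExact
  firstKer_eq_bot := CrossedSeq.firstKer_pushforward α E.isExact E.firstKer_eq_bot
  isExact := E.isExact.pushforward α

/-- The sum of two extensions over `g`, an extension by `M ⊕ M'`. -/
def sum {M M' : LieMod K g} (E : CrossedExt K g k M) (E' : CrossedExt K g k M') :
    CrossedExt K g k (M.prod M') where
  seq := E.seq.sum E'.seq
  firstKer_eq_bot := by
    rw [eq_bot_iff]
    rintro ⟨m, m'⟩ h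
    rw [CrossedSeq.mem_firstKer_sum, E.firstKer_eq_bot, E'.firstKer_eq_bot] at h
    exact Prod.ext h.1 h.2
  isExact := E.isExact.sum E'.isExact

/-- The Baer sum `∇ (E ⊕_g E')`. -/
def baerSum {M : LieMod K g} (E E' : CrossedExt K g k M) : CrossedExt K g k M :=
  (E.sum E').pushforward M.codiag

/-- The extension `0 → M = M → 0 → ⋯ → 0 → g = g → 0`. -/
def zero (k : ℕ) (M : LieMod K g) : CrossedExt K g k M where
  seq := CrossedSeq.zero k M
  firstKer_eq_bot := CrossedSeq.firstKer_zero
  isExact := CrossedSeq.isExact_zero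

/-- The extension with the map out of `M` replaced by its negative. -/
def neg {M : LieMod K g} (E : CrossedExt K g k M) : CrossedExt K g k M where
  seq := E.seq.precomp (-LieModuleHom.id)
  firstKer_eq_bot := by
    rw [CrossedSeq.firstKer_precomp, E.firstKer_eq_bot, eq_bot_iff]
    exact fun m hm => neg_eq_zero.1 hm
  isExact := E.isExact.precomp fun m => ⟨-m, neg_neg m⟩

/-- For an exact sequence `0 → M → M' → M'' → 0` (maps `α`, `β`) and an extension
`0 → M'' → M_{k+1} → ⋯ → g → 0` (first map `f`), the extension
`0 → M → M' → M_{k+1} → ⋯ → g → 0` (first maps `α`, `f β`). -/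
def splice {M M' M'' : LieMod K g} (α : M →ₗ⁅K,g⁆ M') (β : M' →ₗ⁅K,g⁆ M'')
    (hα : Function.Injective α) (hαβ : Function.Exact α β) (hβ : Function.Surjective β)
    (E : CrossedExt K g k M'') : CrossedExt K g (k + 1) M where
  seq := .cons M' α (E.seq.precomp β)
  firstKer_eq_bot := LinearMap.ker_eq_bot.2 hα
  isExact := by
    refine ⟨?_, E.isExact.precomp hβ⟩
    rw [CrossedSeq.firstKer_precomp, E.firstKer_eq_bot]
    ext m
    exact (hαβ m).symm

/-! ### Compatibility with morphisms -/

theorem Rel.refl {M : LieMod K g} (E : CrossedExt K g k M) : Rel E E :=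
  CrossedSeq.MorOver.refl E.seq

theorem Rel.pushforward {M M' : LieMod K g} (α : M →ₗ⁅K,g⁆ M') {E E' : CrossedExt K g k M}
    (h : Rel E E') : Rel (E.pushforward α) (E'.pushforward α) :=
  CrossedSeq.MorOver.pushforward (α := α) (α' := α) (γ := LieModuleHom.id)
    (β := LieModuleHom.id) (fun _ => rfl) E.isExact E'.isExact h

theorem Rel.baerSum {M : LieMod K g} {E E' F F' : CrossedExt K g k M}
    (h : Rel E E') (h' : Rel F F') : Rel (E.baerSum F) (E'.baerSum F') :=
  CrossedSeq.MorOver.pushforward (α := M.codiag) (α' := M.codiag)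
    (γ := LieMod.prodMap LieModuleHom.id LieModuleHom.id) (β := LieModuleHom.id) (fun _ => rfl)
    (E.sum F).isExact (E'.sum F').isExact (CrossedSeq.MorOver.sum h h')

theorem Rel.neg {M : LieMod K g} {E E' : CrossedExt K g k M} (h : Rel E E') :
    Rel E.neg E'.neg :=
  CrossedSeq.MorOver.precomp (γ := -LieModuleHom.id) (γ' := -LieModuleHom.id)
    (α := LieModuleHom.id) (β := LieModuleHom.id) (fun _ => rfl) h

theorem Rel.splice {M M' M'' : LieMod K g} (α : M →ₗ⁅K,g⁆ M') (β : M' →ₗ⁅K,g⁆ M'')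
    (hα : Function.Injective α) (hαβ : Function.Exact α β) (hβ : Function.Surjective β)
    {E E' : CrossedExt K g k M''} (h : Rel E E') :
    Rel (E.splice α β hα hαβ hβ) (E'.splice α β hα hαβ hβ) :=
  ⟨LieModuleHom.id, fun _ => rfl, CrossedSeq.MorOver.precomp (γ := β) (γ' := β)
    (α := LieModuleHom.id) (β := LieModuleHom.id) (fun _ => rfl) h⟩

end CrossedExt

/-- `Opext K g k M` is the set `Opext^{k+2}(g, M)` of equivalence classes of crossed
`(k + 2)`-fold extensions of `g` by `M`, for the equivalence relation generated by the morphisms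
that are the identity on `M` and on `g`. -/
def Opext (K g : Type u) [Field K] [LieRing g] [LieAlgebra K g] (k : ℕ) (M : LieMod K g) :
    Type (u + 1) :=
  Quot (CrossedExt.Rel (K := K) (g := g) (k := k) (M := M))

namespace Opext

variable {K g : Type u} [Field K] [LieRing g] [LieAlgebra K g] {k : ℕ}

/-- The Baer sum of classes. -/
instance {M : LieMod K g} : Add (Opext K g k M) where
  add := Quot.map₂ CrossedExt.baerSum
    (fun _ _ _ h => CrossedExt.Rel.baerSum (.refl _) h)
    (fun _ _ _ h => CrossedExt.Rel.baerSum h (.refl _))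

/-- The class of the zero extension. -/
instance {M : LieMod K g} : Zero (Opext K g k M) where
  zero := Quot.mk _ (CrossedExt.zero k M)

/-- The class of the extension with the map out of `M` replaced by its negative. -/
instance {M : LieMod K g} : Neg (Opext K g k M) where
  neg := Quot.map CrossedExt.neg fun _ _ h => h.neg

/-- The induced map `α_* : Opext^{k+2}(g, M) → Opext^{k+2}(g, M')`. -/
def map (k : ℕ) {M M' : LieMod K g} (α : M →ₗ⁅K,g⁆ M') : Opext K g k M → Opext K g k M' :=
  Quot.map (CrossedExt.pushforward α) fun _ _ h => h.pushforward α

/-- The connecting map `δ : Opext^{k+2}(g, M'') → Opext^{k+3}(g, M)` of a short exact sequence. -/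
def connecting (k : ℕ) {M M' M'' : LieMod K g} (α : M →ₗ⁅K,g⁆ M') (β : M' →ₗ⁅K,g⁆ M'')
    (hα : Function.Injective α) (hαβ : Function.Exact α β) (hβ : Function.Surjective β) :
    Opext K g k M'' → Opext K g (k + 1) M :=
  Quot.map (CrossedExt.splice α β hα hαβ hβ) fun _ _ h => h.splice α β hα hαβ hβ

end Opext

/-! The proof computes `Opext` from a projective crossed extension `U` of `g` by some module `Z`,
just as Yoneda's Ext is computed from a projective resolution. Let `P` be the term of `U` that
follows `Z`. The claim is that `γ ↦ γ_* U` identifies `Opext(g, M)` with `Hom(Z, M)` modulo the maps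
that extend along `Z → P`, and that this turns the Baer sum into the addition of maps.

Surjectivity and the kernel come from a comparison theorem. Every extension `E` by `M` receives a
morphism from `U` over some `γ : Z → M` (`IsProjective.exists_morOver`), whence `E ~ γ_* U`
(`mk_eq_map`). Two such `γ` differ by a map that extends to `P` (`IsProjective.exists_extends`,
`extends_sub`). Hence the set of admissible `γ`, up to extendable maps, is an invariant of the class
(`homs`), and `γ_* U` is zero exactly if `γ` extends (`ofHom_eq_zero_iff`).

The nonlinear end of `U` is the free crossed module over the free Lie algebra `F` on the set `g`,
with one generator for each element of the kernel of `F → g`. Freeness provides maps to other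
crossed modules. For uniqueness, two morphisms from `F` that agree over `g` are combined into one
morphism to the semidirect product of `V` and `L`; its `V`-component is a twisted derivation `d`
with `∂ d = β - β'`, and subtracting `d ∂` from the difference of the two maps on `V` gives a
homotopy with values in `ker ∂`. The other terms of `U` are free modules, each covering the kernel
reached so far.

The group laws are then those of `Hom(Z, M)`. For exactness, let `0 → Z' → X → Z → 0` be exact with
`X` projective, so that the splice of `U` with it is projective one degree higher. The connecting
map sends `γ : Z → M''` to the map `γ' : Z' → M` obtained by lifting `γ` to `X → M'` and restricting
to `Z'`, and the exactness statements become diagram chases with maps of modules. -/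

/-! ### Free modules over a Lie algebra -/

namespace UniversalEnvelopingAlgebra

/-- The enveloping algebra is generated by the image of the Lie algebra. -/
theorem adjoin_range_ι (R L : Type*) [CommRing R] [LieRing L] [LieAlgebra R L] :
    Algebra.adjoin R (Set.range (ι R : L → UniversalEnvelopingAlgebra R L)) = ⊤ := by
  let _ := LieRing.ofAssociativeRing (A := UniversalEnvelopingAlgebra R L)
  set S := Algebra.adjoin R (Set.range (ι R : L → UniversalEnvelopingAlgebra R L)) with hS
  let _ := LieRing.ofAssociativeRing (A := S)
  let j : L →ₗ⁅R⁆ S :=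
    { toFun := fun x => ⟨ι R x, Algebra.subset_adjoin ⟨x, rfl⟩⟩
      map_add' := fun x y => Subtype.ext (map_add (ι R) x y)
      map_smul' := fun t x => Subtype.ext (map_smul (ι R) t x)
      map_lie' := fun {x y} => Subtype.ext (LieHom.map_lie (ι R) x y) }
  -- By the universal property the identity factors through the subalgebra `S`, so `S` is
  -- everything.
  have h : S.val.comp (lift R j) = AlgHom.id R _ := by
    apply hom_ext
    ext x
    change ((lift R j (ι R x) : S) : UniversalEnvelopingAlgebra R L) = ι R x
    rw [lift_ι_apply]
    rfl
  rw [eq_top_iff]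
  intro u _
  have h2 := DFunLike.congr_fun h u
  change ((lift R j u : S) : UniversalEnvelopingAlgebra R L) = u at h2
  rw [← h2]
  exact (lift R j u).2

end UniversalEnvelopingAlgebra

/-- The free module over the Lie algebra `L` on the set `Y`. -/
def FreeLieModule (K L Y : Type u) [Field K] [LieRing L] [LieAlgebra K L] : Type u :=
  Y →₀ UniversalEnvelopingAlgebra K L

namespace FreeLieModule

variable {K L Y : Type u} [Field K] [LieRing L] [LieAlgebra K L]

noncomputable instance : AddCommGroup (FreeLieModule K L Y) :=
  inferInstanceAs (AddCommGroup (Y →₀ UniversalEnvelopingAlgebra K L))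

noncomputable instance : Module K (FreeLieModule K L Y) :=
  inferInstanceAs (Module K (Y →₀ UniversalEnvelopingAlgebra K L))

noncomputable instance : Module (UniversalEnvelopingAlgebra K L) (FreeLieModule K L Y) :=
  inferInstanceAs (Module _ (Y →₀ UniversalEnvelopingAlgebra K L))

instance : SMulCommClass (UniversalEnvelopingAlgebra K L) K (FreeLieModule K L Y) :=
  inferInstanceAs (SMulCommClass _ K (Y →₀ UniversalEnvelopingAlgebra K L))

instance : IsScalarTower K (UniversalEnvelopingAlgebra K L) (FreeLieModule K L Y) :=
  inferInstanceAs (IsScalarTower K _ (Y →₀ UniversalEnvelopingAlgebra K L))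

attribute [local instance 100] LieRing.ofAssociativeRing

noncomputable instance : LieRingModule L (FreeLieModule K L Y) where
  bracket x m := UniversalEnvelopingAlgebra.ι K x • m
  add_lie x y m := by
    rw [map_add, add_smul]
  lie_add x m n := smul_add _ m n
  leibniz_lie x y m := by
    change UniversalEnvelopingAlgebra.ι K x • UniversalEnvelopingAlgebra.ι K y • m =
      UniversalEnvelopingAlgebra.ι K ⁅x, y⁆ • m +
        UniversalEnvelopingAlgebra.ι K y • UniversalEnvelopingAlgebra.ι K x • m
    rw [LieHom.map_lie, LieRing.of_associative_ring_bracket, sub_smul, mul_smul, mul_smul,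
      sub_add_cancel]

theorem lie_def (x : L) (m : FreeLieModule K L Y) :
    ⁅x, m⁆ = UniversalEnvelopingAlgebra.ι K x • m := rfl

instance : LieModule K L (FreeLieModule K L Y) where
  smul_lie t x m := by
    rw [lie_def, lie_def, map_smul, smul_assoc]
  lie_smul t x m := smul_comm _ t m

/-- The generator of the free module belonging to `y`. -/
noncomputable def of (y : Y) : FreeLieModule K L Y := Finsupp.single y 1

/-- Since `L` generates its enveloping algebra, closure under sums, scalars and the action of `L`
already gives closure under the whole enveloping algebra. -/
theorem induction {p : FreeLieModule K L Y → Prop} (of : ∀ y, p (of y)) (zero : p 0)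
    (add : ∀ m n, p m → p n → p (m + n)) (smul : ∀ (t : K) m, p m → p (t • m))
    (lie : ∀ (x : L) m, p m → p ⁅x, m⁆) (m : FreeLieModule K L Y) : p m := by
  have key (u : UniversalEnvelopingAlgebra K L) : ∀ m, p m → p (u • m) := by
    have hu : u ∈ Algebra.adjoin K
        (Set.range (UniversalEnvelopingAlgebra.ι K : L → UniversalEnvelopingAlgebra K L)) := by
      rw [UniversalEnvelopingAlgebra.adjoin_range_ι]; trivial
    induction hu using Algebra.adjoin_induction with
    | mem x hx =>
      obtain ⟨x, rfl⟩ := hx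
      exact fun m hm => lie x m hm
    | algebraMap t =>
      intro m hm
      rw [algebraMap_smul]
      exact smul t m hm
    | add u v _ _ hu hv =>
      intro m hm
      rw [add_smul]
      exact add _ _ (hu m hm) (hv m hm)
    | mul u v _ _ hu hv =>
      intro m hm
      rw [mul_smul]
      exact hu _ (hv m hm)
  refine Finsupp.induction_linear (motive := p) m zero (fun m n => add m n) fun y a => ?_
  have h : (Finsupp.single y a : Y →₀ UniversalEnvelopingAlgebra K L) =
      a • Finsupp.single y 1 := by simp
  rw [h]
  exact key a _ (of y)

section lift

variable {N : Type u} [AddCommGroup N] [Module K N] [LieRingModule L N] [LieModule K L N]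

/-- The linear map underlying `FreeLieModule.lift`. -/
noncomputable def liftLinear (f : Y → N) : (Y →₀ UniversalEnvelopingAlgebra K L) →ₗ[K] N :=
  Finsupp.lsum K fun y => (LinearMap.applyₗ (R := K) (f y)).comp
    (UniversalEnvelopingAlgebra.lift K (LieModule.toEnd K L N)).toLinearMap

theorem liftLinear_single (f : Y → N) (y : Y) (a : UniversalEnvelopingAlgebra K L) :
    liftLinear f (Finsupp.single y a) =
      UniversalEnvelopingAlgebra.lift K (LieModule.toEnd K L N) a (f y) := by
  rw [liftLinear, Finsupp.lsum_single]
  rfl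

theorem liftLinear_ι_smul (f : Y → N) (x : L) (m : Y →₀ UniversalEnvelopingAlgebra K L) :
    liftLinear f (UniversalEnvelopingAlgebra.ι K x • m) = ⁅x, liftLinear f m⁆ := by
  induction m using Finsupp.induction_linear with
  | zero => rw [smul_zero, map_zero, lie_zero]
  | add m n hm hn => rw [smul_add, map_add, map_add, lie_add, hm, hn]
  | single y a =>
    rw [Finsupp.smul_single, liftLinear_single, liftLinear_single, smul_eq_mul, map_mul,
      UniversalEnvelopingAlgebra.lift_ι_apply]
    rfl

/-- The morphism out of the free module with given values on the generators. -/
noncomputable def lift (f : Y → N) : FreeLieModule K L Y →ₗ⁅K,L⁆ N where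
  toFun m := liftLinear f m
  map_add' m n := map_add (liftLinear f) m n
  map_smul' t m := map_smul (liftLinear f) t m
  map_lie' {x m} := liftLinear_ι_smul f x m

theorem lift_of (f : Y → N) (y : Y) : lift (K := K) (L := L) f (of y) = f y := by
  refine (liftLinear_single f y 1).trans ?_
  rw [map_one]
  rfl

end lift

end FreeLieModule

/-! ### Projective modules, lifting and descent of morphisms -/

namespace LieMod

variable {K g : Type u} [Field K] [LieRing g] [LieAlgebra K g]

/-- Projectivity: morphisms out of `P` lift along any `q` whose range contains their values. -/
def IsProjective (P : LieMod K g) : Prop :=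
  ∀ (B D : LieMod K g) (q : B →ₗ⁅K,g⁆ D) (f : P →ₗ⁅K,g⁆ D), (∀ p, ∃ b, q b = f p) →
    ∃ h : P →ₗ⁅K,g⁆ B, ∀ p, q (h p) = f p

/-- The free module on the elements of `Z`. -/
noncomputable def cover (Z : LieMod K g) : LieMod K g where
  carrier := FreeLieModule K g Z

/-- The surjection `cover Z → Z`. -/
noncomputable def coverMap (Z : LieMod K g) : Z.cover →ₗ⁅K,g⁆ Z :=
  FreeLieModule.lift (K := K) (L := g) (fun z : Z => z)

theorem coverMap_surjective (Z : LieMod K g) : Function.Surjective Z.coverMap :=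
  fun z => ⟨FreeLieModule.of z, FreeLieModule.lift_of _ z⟩

theorem isProjective_cover (Z : LieMod K g) : Z.cover.IsProjective := by
  intro B D q f hf
  choose b hb using fun z : Z => hf (FreeLieModule.of z)
  refine ⟨FreeLieModule.lift (K := K) (L := g) b, fun p => ?_⟩
  induction p using FreeLieModule.induction with
  | of z => rw [← hb z]; exact congrArg q (FreeLieModule.lift_of b z)
  | zero => exact (congrArg q (map_zero _)).trans ((map_zero q).trans (map_zero f).symm)
  | add m n hm hn =>
    refine (congrArg q (map_add _ m n)).trans ((map_add q _ _).trans ?_)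
    exact (congrArg₂ _ hm hn).trans (map_add f m n).symm
  | smul t m hm =>
    refine (congrArg q (map_smul _ t m)).trans ((map_smul q _ _).trans ?_)
    exact (congrArg _ hm).trans (map_smul f t m).symm
  | lie x m hm =>
    refine (congrArg q (LieModuleHom.map_lie _ x m)).trans ((LieModuleHom.map_lie q _ _).trans ?_)
    exact (congrArg _ hm).trans (LieModuleHom.map_lie f x m).symm

/-- If `f` takes values in the range of `q`, it lifts along `q` provided its source is projective
or `q` is injective. -/
theorem exists_lift {A B D : LieMod K g} (q : B →ₗ⁅K,g⁆ D) (f : A →ₗ⁅K,g⁆ D)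
    (h : A.IsProjective ∨ Function.Injective q) (hf : ∀ a, ∃ b, q b = f a) :
    ∃ l : A →ₗ⁅K,g⁆ B, ∀ a, q (l a) = f a := by
  obtain h | h := h
  · exact h B D q f hf
  · choose l hl using hf
    exact ⟨{ toFun := l
             map_add' := fun a b => h (by rw [map_add, hl, hl, hl, map_add])
             map_smul' := fun t a => h (by rw [RingHom.id_apply, map_smul, hl, hl, map_smul])
             map_lie' := fun {x a} => h (by
              rw [LieModuleHom.map_lie, hl, hl, LieModuleHom.map_lie]) }, hl⟩

/-- A morphism descends along a surjection whose kernel it kills. -/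
theorem exists_desc {A B D : LieMod K g} (q : A →ₗ⁅K,g⁆ D) (hq : Function.Surjective q)
    (f : A →ₗ⁅K,g⁆ B) (hf : ∀ a, q a = 0 → f a = 0) :
    ∃ l : D →ₗ⁅K,g⁆ B, ∀ a, l (q a) = f a := by
  have hf' {a b} (h : q a = q b) : f a = f b := by
    rw [← sub_eq_zero, ← map_sub]
    exact hf _ (by rw [map_sub, h, sub_self])
  choose s hs using hq
  exact ⟨{ toFun := fun d => f (s d)
           map_add' := fun a b => by rw [← map_add]; exact hf' (by rw [map_add, hs, hs, hs])
           map_smul' := fun t a => by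
            rw [RingHom.id_apply, ← map_smul]; exact hf' (by rw [map_smul, hs, hs])
           map_lie' := fun {x a} => by
            rw [← LieModuleHom.map_lie]; exact hf' (by rw [LieModuleHom.map_lie, hs, hs]) },
    fun a => hf' (hs _)⟩

/-- The kernel of a morphism. -/
def kernel {A B : LieMod K g} (q : A →ₗ⁅K,g⁆ B) : LieMod K g where
  carrier := q.ker

/-- The inclusion of the kernel. -/
def kernelIncl {A B : LieMod K g} (q : A →ₗ⁅K,g⁆ B) : kernel q →ₗ⁅K,g⁆ A := q.ker.incl

theorem kernelIncl_injective {A B : LieMod K g} (q : A →ₗ⁅K,g⁆ B) :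
    Function.Injective (kernelIncl q) := Subtype.val_injective

theorem exact_kernelIncl {A B : LieMod K g} (q : A →ₗ⁅K,g⁆ B) :
    Function.Exact (kernelIncl q) q := by
  intro a
  exact ⟨fun h => ⟨⟨a, h⟩, rfl⟩, fun ⟨b, hb⟩ => hb ▸ b.2⟩

/-- A map that is linear over `L` is linear over its quotient `g`. -/
def ofComap {L : Type u} [LieRing L] [LieAlgebra K L] {φ : L →ₗ⁅K⁆ g}
    (hφ : Function.Surjective φ) {A B : LieMod K g} (f : A.comap φ →ₗ⁅K,L⁆ B.comap φ) :
    A →ₗ⁅K,g⁆ B where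
  toFun := f
  map_add' := f.map_add
  map_smul' := f.map_smul
  map_lie' {x m} := by
    obtain ⟨x, rfl⟩ := hφ x
    exact f.map_lie x m

end LieMod

/-! ### Semidirect products, twisted derivations and free crossed modules -/

namespace LieSubmodule.Quotient

variable {K L M M' : Type u} [Field K] [LieRing L] [LieAlgebra K L]
  [AddCommGroup M] [Module K M] [LieRingModule L M] [LieModule K L M]
  [AddCommGroup M'] [Module K M'] [LieRingModule L M']

/-- The morphism out of a quotient induced by a morphism that kills the submodule. -/
def desc (N : LieSubmodule K L M) (f : M →ₗ⁅K,L⁆ M') (hf : N ≤ f.ker) : M ⧸ N →ₗ⁅K,L⁆ M' :=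
  { N.toSubmodule.liftQ f.toLinearMap hf with
    map_lie' := by
      intro x m
      obtain ⟨m, rfl⟩ := surjective_mk' N m
      exact f.map_lie x m }

end LieSubmodule.Quotient

namespace CrossedModule

variable {K : Type u} [Field K]

/-- The semidirect product of `V`, with the Lie bracket `⁅∂ v, w⁆`, and `L`. -/
def Semidirect (C : CrossedModule K) : Type u := C.V × C.L

namespace Semidirect

variable (C : CrossedModule K)

instance : AddCommGroup C.Semidirect := inferInstanceAs (AddCommGroup (C.V × C.L))

instance : Module K C.Semidirect := inferInstanceAs (Module K (C.V × C.L))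

/-- `C.alt` is what makes this bracket alternating in every characteristic. Together with `source`
and `target`, a morphism into this Lie algebra encodes two morphisms to `L` and a twisted derivation
between them. -/
instance : LieRing C.Semidirect where
  bracket x y := (⁅C.bd x.1 + x.2, y.1⁆ - ⁅y.2, x.1⁆, ⁅x.2, y.2⁆)
  add_lie x y z := by
    refine Prod.ext ?_ (add_lie x.2 y.2 z.2)
    change ⁅C.bd (x.1 + y.1) + (x.2 + y.2), z.1⁆ - ⁅z.2, x.1 + y.1⁆ =
      ⁅C.bd x.1 + x.2, z.1⁆ - ⁅z.2, x.1⁆ + (⁅C.bd y.1 + y.2, z.1⁆ - ⁅z.2, y.1⁆)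
    simp only [map_add, add_lie, lie_add]
    abel
  lie_add x y z := by
    refine Prod.ext ?_ (lie_add x.2 y.2 z.2)
    change ⁅C.bd x.1 + x.2, y.1 + z.1⁆ - ⁅y.2 + z.2, x.1⁆ =
      ⁅C.bd x.1 + x.2, y.1⁆ - ⁅y.2, x.1⁆ + (⁅C.bd x.1 + x.2, z.1⁆ - ⁅z.2, x.1⁆)
    simp only [add_lie, lie_add]
    abel
  lie_self x := by
    refine Prod.ext ?_ (lie_self x.2)
    change ⁅C.bd x.1 + x.2, x.1⁆ - ⁅x.2, x.1⁆ = 0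
    rw [add_lie, C.alt, zero_add, sub_self]
  leibniz_lie x y z := by
    refine Prod.ext ?_ (leibniz_lie x.2 y.2 z.2)
    change ⁅C.bd x.1 + x.2, ⁅C.bd y.1 + y.2, z.1⁆ - ⁅z.2, y.1⁆⁆ - ⁅⁅y.2, z.2⁆, x.1⁆ =
      ⁅C.bd (⁅C.bd x.1 + x.2, y.1⁆ - ⁅y.2, x.1⁆) + ⁅x.2, y.2⁆, z.1⁆ -
          ⁅z.2, ⁅C.bd x.1 + x.2, y.1⁆ - ⁅y.2, x.1⁆⁆ +
        (⁅C.bd y.1 + y.2, ⁅C.bd x.1 + x.2, z.1⁆ - ⁅z.2, x.1⁆⁆ - ⁅⁅x.2, z.2⁆, y.1⁆)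
    -- The one place where the Jacobi identity needs `C.skew`; the rest is the module axiom.
    have h : ⁅C.bd y.1, ⁅z.2, x.1⁆⁆ = ⁅C.bd x.1, ⁅z.2, y.1⁆⁆ - ⁅z.2, ⁅C.bd x.1, y.1⁆⁆ := by
      rw [C.skew, LieModuleHom.map_lie, lie_lie, neg_sub]
    have h' : ⁅⁅y.2, C.bd x.1⁆, z.1⁆ = -⁅⁅C.bd x.1, y.2⁆, z.1⁆ := by
      rw [← lie_skew, neg_lie]
    rw [map_sub, LieModuleHom.map_lie, LieModuleHom.map_lie]
    simp only [add_lie, lie_add, sub_lie, lie_sub, lie_lie, h, h']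
    abel

instance : LieAlgebra K C.Semidirect where
  lie_smul t x y := by
    refine Prod.ext ?_ (lie_smul t x.2 y.2)
    change ⁅C.bd x.1 + x.2, t • y.1⁆ - ⁅t • y.2, x.1⁆ =
      t • (⁅C.bd x.1 + x.2, y.1⁆ - ⁅y.2, x.1⁆)
    rw [lie_smul, smul_lie, smul_sub]

/-- The projection to `L`. -/
def source : C.Semidirect →ₗ⁅K⁆ C.L where
  toFun x := x.2
  map_add' _ _ := rfl
  map_smul' _ _ := rfl
  map_lie' := rfl

/-- The map `(v, x) ↦ ∂ v + x`. -/
def target : C.Semidirect →ₗ⁅K⁆ C.L where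
  toFun x := C.bd x.1 + x.2
  map_add' x y := by
    change C.bd (x.1 + y.1) + (x.2 + y.2) = _
    rw [map_add, add_add_add_comm]
  map_smul' t x := by
    change C.bd (t • x.1) + t • x.2 = t • (_ + _)
    rw [map_smul, smul_add]
  map_lie' {x y} := by
    change C.bd (⁅C.bd x.1 + x.2, y.1⁆ - ⁅y.2, x.1⁆) + ⁅x.2, y.2⁆ =
      ⁅C.bd x.1 + x.2, C.bd y.1 + y.2⁆
    have h : ⁅y.2, C.bd x.1⁆ = -⁅C.bd x.1, y.2⁆ := (lie_skew _ _).symm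
    rw [map_sub, LieModuleHom.map_lie, LieModuleHom.map_lie]
    simp only [add_lie, lie_add, h]
    abel

end Semidirect

/-- Two morphisms `β`, `β'` from a free Lie algebra to `L` that agree modulo the image of `∂` differ
by `∂ d`, where `d` is a derivation twisted by `β` and `β'`. -/
theorem exists_twisted_derivation (C : CrossedModule K) {X : Type u}
    (β β' : FreeLieAlgebra K X →ₗ⁅K⁆ C.L) (h : ∀ x, ∃ v, C.bd v = β x - β' x) :
    ∃ d : FreeLieAlgebra K X →ₗ[K] C.V, (∀ x, C.bd (d x) = β x - β' x) ∧
      ∀ x y, d ⁅x, y⁆ = ⁅β x, d y⁆ - ⁅β' y, d x⁆ := by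
  choose v hv using fun x => h (FreeLieAlgebra.of K x)
  -- On generators `l` has source `β'` and target `∂ v + β' = β`, hence everywhere. Its
  -- `V`-component is `d`, and the twisted Leibniz rule is the first coordinate of the bracket.
  let l : FreeLieAlgebra K X →ₗ⁅K⁆ C.Semidirect :=
    FreeLieAlgebra.lift K fun x => ((v x, β' (FreeLieAlgebra.of K x)) : C.V × C.L)
  have hs : (Semidirect.source C).comp l = β' := by
    refine FreeLieAlgebra.hom_ext fun x => ?_
    exact congrArg (Semidirect.source C) (FreeLieAlgebra.lift_of_apply (R := K) _ x)
  have ht : (Semidirect.target C).comp l = β := by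
    refine FreeLieAlgebra.hom_ext fun x => ?_
    refine (congrArg (Semidirect.target C) (FreeLieAlgebra.lift_of_apply (R := K) _ x)).trans ?_
    change C.bd (v x) + β' (FreeLieAlgebra.of K x) = _
    rw [hv, sub_add_cancel]
  have hs' (x) : (l x).2 = β' x := LieHom.congr_fun hs x
  have ht' (x) : C.bd (l x).1 + (l x).2 = β x := LieHom.congr_fun ht x
  refine ⟨⟨⟨fun x => (l x).1, fun x y => congrArg Prod.fst (l.map_add x y)⟩,
    fun t x => congrArg Prod.fst (l.map_smul t x)⟩, fun x => ?_, fun x y => ?_⟩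
  · change C.bd (l x).1 = _
    rw [← ht', hs', add_sub_cancel_right]
  · change (l ⁅x, y⁆).1 = ⁅β x, (l y).1⁆ - ⁅β' y, (l x).1⁆
    rw [← ht', ← hs' y]
    exact congrArg Prod.fst (l.map_lie x y)

section Free

variable {L Y : Type u} [LieRing L] [LieAlgebra K L] (b : Y → L)

/-- The boundary map on the free module. -/
noncomputable def freeBd : FreeLieModule K L Y →ₗ⁅K,L⁆ L := FreeLieModule.lift b

/-- The submodule of the free module generated by the relations of a crossed module. -/
noncomputable def freeRel : LieSubmodule K L (FreeLieModule K L Y) :=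
  LieSubmodule.lieSpan K L ({m | ∃ v w, m = ⁅freeBd b v, w⁆ + ⁅freeBd b w, v⁆} ∪
    {m | ∃ v, m = ⁅freeBd b v, v⁆})

variable {b} in
theorem freeRel_le_ker {N : Type u} [AddCommGroup N] [Module K N] [LieRingModule L N]
    [LieModule K L N] {f : FreeLieModule K L Y →ₗ⁅K,L⁆ N}
    (h : ∀ v w, ⁅freeBd b v, f w⁆ + ⁅freeBd b w, f v⁆ = 0)
    (h' : ∀ v, ⁅freeBd b v, f v⁆ = 0) : freeRel b ≤ f.ker := by
  refine LieSubmodule.lieSpan_le.2 ?_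
  rintro _ (⟨v, w, rfl⟩ | ⟨v, rfl⟩)
  · refine (LieModuleHom.mem_ker).2 ?_
    rw [map_add, LieModuleHom.map_lie, LieModuleHom.map_lie, h]
  · refine (LieModuleHom.mem_ker).2 ?_
    rw [LieModuleHom.map_lie, h']

/-- The free module modulo the relations of a crossed module. -/
noncomputable abbrev freeV : LieMod K L where
  carrier := FreeLieModule K L Y ⧸ freeRel b

/-- The quotient map from the free module. -/
noncomputable def freeMk : FreeLieModule K L Y →ₗ⁅K,L⁆ freeV (K := K) b :=
  LieSubmodule.Quotient.mk' (freeRel b)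

theorem freeMk_surjective : Function.Surjective (freeMk (K := K) b) :=
  LieSubmodule.Quotient.surjective_mk' _

/-- The free crossed module over `L` on a family of elements of `L`. -/
noncomputable def free : CrossedModule K where
  L := L
  V := freeV b
  bd := LieSubmodule.Quotient.desc (freeRel b) (freeBd b) (freeRel_le_ker
    (fun v w => by rw [← lie_skew, neg_add_cancel]) fun v => lie_self _)
  skew v w := by
    obtain ⟨v, rfl⟩ := freeMk_surjective b v
    obtain ⟨w, rfl⟩ := freeMk_surjective b w
    rw [eq_neg_iff_add_eq_zero]
    exact (LieSubmodule.Quotient.mk_eq_zero _).2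
      (LieSubmodule.subset_lieSpan (Or.inl ⟨v, w, rfl⟩))
  alt v := by
    obtain ⟨v, rfl⟩ := freeMk_surjective b v
    exact (LieSubmodule.Quotient.mk_eq_zero _).2
      (LieSubmodule.subset_lieSpan (Or.inr ⟨v, rfl⟩))

/-- The boundary map of the free crossed module. -/
noncomputable def freeVBd : freeV (K := K) b →ₗ⁅K,L⁆ L := (free b).bd

theorem freeVBd_of (y : Y) : freeVBd (K := K) b (freeMk b (FreeLieModule.of y)) = b y :=
  FreeLieModule.lift_of b y

variable {b} in
theorem freeV_induction {p : freeV (K := K) b → Prop} (of : ∀ y, p (freeMk b (FreeLieModule.of y)))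
    (zero : p 0) (add : ∀ m n, p m → p n → p (m + n)) (smul : ∀ (t : K) m, p m → p (t • m))
    (lie : ∀ (x : L) m, p m → p ⁅x, m⁆) (m : freeV (K := K) b) : p m := by
  obtain ⟨m, rfl⟩ := freeMk_surjective b m
  induction m using FreeLieModule.induction with
  | of y => exact of y
  | zero => rw [map_zero]; exact zero
  | add m n hm hn => rw [map_add]; exact add _ _ hm hn
  | smul t m hm => rw [map_smul]; exact smul t _ hm
  | lie x m hm => rw [LieModuleHom.map_lie]; exact lie x _ hm

/-- The relations are required of an arbitrary `f` with the prescribed values, so that they can be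
verified by induction from these values without reference to the construction of the lift. -/
theorem exists_free_desc_aux {N : LieMod K L} (v : Y → N)
    (h : ∀ f : FreeLieModule K L Y →ₗ⁅K,L⁆ N, (∀ y, f (FreeLieModule.of y) = v y) →
      (∀ m n, ⁅freeBd b m, f n⁆ + ⁅freeBd b n, f m⁆ = 0) ∧ ∀ m, ⁅freeBd b m, f m⁆ = 0) :
    ∃ F : freeV (K := K) b →ₗ⁅K,L⁆ N, ∀ y, F (freeMk b (FreeLieModule.of y)) = v y := by
  obtain ⟨h1, h2⟩ := h (FreeLieModule.lift v) (FreeLieModule.lift_of v)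
  exact ⟨LieSubmodule.Quotient.desc (freeRel b) (FreeLieModule.lift v) (freeRel_le_ker h1 h2),
    FreeLieModule.lift_of v⟩

/-- The morphism out of a free crossed module with given values on generators, covering a morphism
`β` of Lie algebras, provided it respects the relations. -/
theorem exists_free_desc {L' : Type u} [LieRing L'] [LieAlgebra K L'] (β : L →ₗ⁅K⁆ L')
    {N : LieMod K L'} (v : Y → N)
    (h : ∀ f : FreeLieModule K L Y →ₗ[K] N, (∀ y, f (FreeLieModule.of y) = v y) →
      (∀ x m, f ⁅x, m⁆ = ⁅β x, f m⁆) →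
      (∀ m n, ⁅β (freeBd b m), f n⁆ + ⁅β (freeBd b n), f m⁆ = 0) ∧
        ∀ m, ⁅β (freeBd b m), f m⁆ = 0) :
    ∃ F : freeV (K := K) b →ₗ[K] N, (∀ y, F (freeMk b (FreeLieModule.of y)) = v y) ∧
      ∀ x m, F ⁅x, m⁆ = ⁅β x, F m⁆ := by
  obtain ⟨F, hF⟩ := exists_free_desc_aux b (N := N.comap β) v fun f hf =>
    h f.toLinearMap hf fun x m => f.map_lie x m
  exact ⟨F.toLinearMap, hF, fun x m => F.map_lie x m⟩

/-- A morphism `β` of Lie algebras extends to a map from a free crossed module to a crossed module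
as soon as the generators can be mapped. -/
theorem exists_free_map (C : CrossedModule K) (β : L →ₗ⁅K⁆ C.L) (v : Y → C.V)
    (hv : ∀ y, C.bd (v y) = β (b y)) :
    ∃ F : freeV (K := K) b →ₗ[K] C.V, (∀ x m, F ⁅x, m⁆ = ⁅β x, F m⁆) ∧
      ∀ m, C.bd (F m) = β (freeVBd b m) := by
  obtain ⟨F, hF, hF'⟩ := exists_free_desc b β v fun f hf hf' => by
    -- Once `f` is compatible with the boundary maps, the relations to be killed are the crossed
    -- module identities of `C`.
    have hb (m) : C.bd (f m) = β (freeBd b m) := by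
      induction m using FreeLieModule.induction with
      | of y => rw [hf, hv, freeBd, FreeLieModule.lift_of]
      | zero => simp only [map_zero]
      | add m n hm hn => simp only [map_add, hm, hn]
      | smul t m hm => simp only [map_smul, hm]
      | lie x m hm => rw [hf', LieModuleHom.map_lie, LieModuleHom.map_lie, LieHom.map_lie, hm]
    exact ⟨fun m n => by rw [← hb, ← hb, C.skew, neg_add_cancel], fun m => by rw [← hb, C.alt]⟩
  refine ⟨F, hF', fun m => ?_⟩
  induction m using freeV_induction with
  | of y => rw [hF, hv, freeVBd_of]
  | zero => simp only [map_zero]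
  | add m n hm hn => simp only [map_add, hm, hn]
  | smul t m hm => simp only [map_smul, hm]
  | lie x m hm => rw [hF', LieModuleHom.map_lie, LieModuleHom.map_lie, LieHom.map_lie, hm]

section

variable {g : Type u} [LieRing g] [LieAlgebra K g] (p : L →ₗ⁅K⁆ g)

theorem map_free_bd (hb : ∀ y, p (b y) = 0) (m : freeV (K := K) b) : p (freeVBd b m) = 0 := by
  induction m using freeV_induction with
  | of y => rw [freeVBd_of, hb]
  | zero => simp only [map_zero]
  | add m n hm hn => simp only [map_add, hm, hn, add_zero]
  | smul t m hm => simp only [map_smul, hm, smul_zero]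
  | lie x m hm => rw [LieModuleHom.map_lie, LieHom.map_lie, hm, lie_zero]

/-- Maps from a free crossed module to modules over its cokernel lift along surjections. -/
theorem exists_free_lift (hb : ∀ y, p (b y) = 0) {B D : LieMod K g} (q : B →ₗ⁅K,g⁆ D)
    (hq : Function.Surjective q)
    (f : freeV (K := K) b →ₗ[K] D) (hf : ∀ x m, f ⁅x, m⁆ = ⁅p x, f m⁆) :
    ∃ F : freeV (K := K) b →ₗ[K] B, (∀ x m, F ⁅x, m⁆ = ⁅p x, F m⁆) ∧ ∀ m, q (F m) = f m := by
  have h0 (m) : p (freeBd b m) = 0 := map_free_bd b p hb (freeMk b m)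
  choose v hv using fun y => hq (f (freeMk b (FreeLieModule.of y)))
  -- The boundaries act trivially on a `g`-module, so the relations impose no condition and any
  -- choice of values on generators works.
  obtain ⟨F, hF, hF'⟩ := exists_free_desc b p v fun l _ _ =>
    ⟨fun m n => by rw [h0, h0, zero_lie, zero_lie, add_zero], fun m => by rw [h0, zero_lie]⟩
  refine ⟨F, hF', fun m => ?_⟩
  induction m using freeV_induction with
  | of y => rw [hF, hv]
  | zero => simp only [map_zero]
  | add m n hm hn => simp only [map_add, hm, hn]
  | smul t m hm => simp only [map_smul, hm]
  | lie x m hm => rw [hF', LieModuleHom.map_lie, hf, hm]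

end

end Free

end CrossedModule

/-! ### Crossed modules over `g`: the kernel of the boundary map, homotopies, projectivity -/

namespace CrossedModuleOver

variable {K g : Type u} [Field K] [LieRing g] [LieAlgebra K g]

/-- Writing `x - y = ∂ w`, one has `⁅∂ w, v⁆ = -⁅∂ v, w⁆ = 0`. This is why `ker ∂` is a module over
`g`. -/
theorem lie_eq_of_proj_eq (C : CrossedModuleOver K g) {x y : C.L} (h : C.proj x = C.proj y)
    {v : C.V} (hv : C.bd v = 0) : ⁅x, v⁆ = ⁅y, v⁆ := by
  obtain ⟨w, hw⟩ := (C.exact_bd_proj (x - y)).1 (by rw [map_sub, h, sub_self])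
  rw [← sub_eq_zero, ← sub_lie, ← hw, C.skew, hv, zero_lie, neg_zero]

theorem bd_lie_eq_zero (C : CrossedModuleOver K g) (x : C.L) {v : C.V} (hv : C.bd v = 0) :
    C.bd ⁅x, v⁆ = 0 := by
  rw [LieModuleHom.map_lie, hv, lie_zero]

/-- The action of `g` on the kernel of `∂`, through arbitrary preimages in `L`. -/
noncomputable instance kerLieRingModule (C : CrossedModuleOver K g) :
    LieRingModule g (LinearMap.ker C.bd.toLinearMap) where
  bracket z v := ⟨⁅Function.surjInv C.proj_surjective z, v.1⁆, C.bd_lie_eq_zero _ v.2⟩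
  add_lie z z' v := Subtype.ext <| by
    change _ = _ + _
    rw [← add_lie]
    exact C.lie_eq_of_proj_eq (by simp only [map_add, Function.surjInv_eq]) v.2
  lie_add z v w := Subtype.ext (lie_add _ v.1 w.1)
  leibniz_lie z z' v := Subtype.ext <| by
    change ⁅_, ⁅_, _⁆⁆ = ⁅_, _⁆ + ⁅_, ⁅_, _⁆⁆
    rw [leibniz_lie]
    refine congrArg (· + _) (C.lie_eq_of_proj_eq ?_ v.2)
    simp only [LieHom.map_lie, Function.surjInv_eq]

theorem coe_lie_ker (C : CrossedModuleOver K g) (x : C.L) (v : LinearMap.ker C.bd.toLinearMap) :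
    ((⁅C.proj x, v⁆ : LinearMap.ker C.bd.toLinearMap) : C.V) = ⁅x, (v : C.V)⁆ :=
  C.lie_eq_of_proj_eq (Function.surjInv_eq _ _) v.2

instance kerLieModule (C : CrossedModuleOver K g) :
    LieModule K g (LinearMap.ker C.bd.toLinearMap) where
  smul_lie t z v := Subtype.ext <| by
    obtain ⟨x, rfl⟩ := C.proj_surjective z
    rw [← map_smul, coe_lie_ker, smul_lie]
    exact congrArg _ (C.coe_lie_ker x v).symm
  lie_smul t z v := Subtype.ext (lie_smul t _ v.1)

/-- The kernel of `∂`, a module over `g`. -/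
noncomputable def kerMod (C : CrossedModuleOver K g) : LieMod K g where
  carrier := LinearMap.ker C.bd.toLinearMap

/-- The inclusion of the kernel of `∂` into `V`. -/
noncomputable def kerIncl (C : CrossedModuleOver K g) : C.kerMod.comap C.proj →ₗ⁅K,C.L⁆ C.V where
  toFun v := v.1
  map_add' _ _ := rfl
  map_smul' _ _ := rfl
  map_lie' {x v} := C.coe_lie_ker x v

theorem kerIncl_injective (C : CrossedModuleOver K g) : Function.Injective C.kerIncl :=
  Subtype.val_injective

theorem exact_kerIncl (C : CrossedModuleOver K g) : Function.Exact C.kerIncl C.bd :=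
  fun v => ⟨fun h => ⟨⟨v, h⟩, rfl⟩, fun ⟨w, hw⟩ => hw ▸ w.2⟩

/-- A map `A → V` killed by `∂` as a map into the kernel. -/
noncomputable def toKer (C : CrossedModuleOver K g) {A : LieMod K g}
    (ι : A.comap C.proj →ₗ⁅K,C.L⁆ C.V) (h : ∀ a, C.bd (ι a) = 0) : A →ₗ⁅K,g⁆ C.kerMod where
  toFun a := ⟨ι a, h a⟩
  map_add' a b := Subtype.ext (ι.map_add a b)
  map_smul' t a := Subtype.ext (ι.map_smul t a)
  map_lie' {z a} := Subtype.ext <| by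
    obtain ⟨x, rfl⟩ := C.proj_surjective z
    exact (ι.map_lie x a).trans (C.coe_lie_ker x ⟨ι a, h a⟩).symm

/-- The map between the kernels induced by a map of crossed modules over `g`. -/
noncomputable def kerMap {C C' : CrossedModuleOver K g}
    (φ : CrossedModule.Hom C.toCrossedModule C'.toCrossedModule)
    (hφ : ∀ x, C'.proj (φ.onL x) = C.proj x) : C.kerMod →ₗ⁅K,g⁆ C'.kerMod where
  toFun v := ⟨φ.onV v.1, (φ.comm v.1).trans (by rw [show C.bd v.1 = 0 from v.2, map_zero])⟩
  map_add' v w := Subtype.ext (φ.onV.map_add v.1 w.1)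
  map_smul' t v := Subtype.ext (φ.onV.map_smul t v.1)
  map_lie' {z v} := Subtype.ext <| by
    obtain ⟨x, rfl⟩ := C.proj_surjective z
    refine (congrArg φ.onV (C.coe_lie_ker x v)).trans ((φ.map_lie x v.1).trans ?_)
    rw [← hφ]
    exact (C'.coe_lie_ker (φ.onL x) ⟨φ.onV v.1, _⟩).symm

/-- Projectivity of a crossed module over `g`: it maps to every other one over `g`, any two such
maps are homotopic, and maps from it to `g`-modules lift along surjections. -/
structure IsProjective (C : CrossedModuleOver K g) : Prop where
  exists_hom (C' : CrossedModuleOver K g) :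
    ∃ φ : CrossedModule.Hom C.toCrossedModule C'.toCrossedModule,
      ∀ x, C'.proj (φ.onL x) = C.proj x
  homotopy (C' : CrossedModuleOver K g)
    (φ φ' : CrossedModule.Hom C.toCrossedModule C'.toCrossedModule)
    (hφ : ∀ x, C'.proj (φ.onL x) = C.proj x) (hφ' : ∀ x, C'.proj (φ'.onL x) = C.proj x) :
    ∃ h : C.V →ₗ⁅K,C.L⁆ C'.kerMod.comap C.proj,
      ∀ v, C.bd v = 0 → C'.kerIncl (h v) = φ.onV v - φ'.onV v
  lift (B D : LieMod K g) (q : B →ₗ⁅K,g⁆ D) (hq : Function.Surjective q)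
    (f : C.V →ₗ⁅K,C.L⁆ D.comap C.proj) :
    ∃ h : C.V →ₗ⁅K,C.L⁆ B.comap C.proj, ∀ v, q (h v) = f v

/-- For a surjection `L → g`, the free crossed module over `L` on the elements of its kernel. -/
noncomputable def free {L : Type u} [LieRing L] [LieAlgebra K L] (p : L →ₗ⁅K⁆ g)
    (hp : Function.Surjective p) : CrossedModuleOver K g where
  toCrossedModule := CrossedModule.free (K := K) (Subtype.val : p.ker → L)
  proj := p
  proj_surjective := hp
  exact_bd_proj x := by
    constructor
    · intro hx
      exact ⟨CrossedModule.freeMk _ (FreeLieModule.of ⟨x, hx⟩),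
        CrossedModule.freeVBd_of (K := K) (Subtype.val : p.ker → L) ⟨x, hx⟩⟩
    · rintro ⟨v, rfl⟩
      exact CrossedModule.map_free_bd _ p (fun y => y.2) v

section

variable {L : Type u} [LieRing L] [LieAlgebra K L] (p : L →ₗ⁅K⁆ g) (hp : Function.Surjective p)

/-- A morphism of Lie algebras over `g` extends to the free crossed module. -/
theorem free_exists_hom (C : CrossedModuleOver K g) (β : L →ₗ⁅K⁆ C.L)
    (hβ : ∀ x, C.proj (β x) = p x) :
    ∃ φ : CrossedModule.Hom (free p hp).toCrossedModule C.toCrossedModule,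
      ∀ x, C.proj (φ.onL x) = (free p hp).proj x := by
  choose v hv using fun y : p.ker => (C.exact_bd_proj (β y)).1 ((hβ y).trans y.2)
  obtain ⟨F, hF, hFb⟩ := CrossedModule.exists_free_map _ C.toCrossedModule β v hv
  exact ⟨⟨F, β, hFb, hF⟩, hβ⟩

theorem free_lift (B D : LieMod K g) (q : B →ₗ⁅K,g⁆ D) (hq : Function.Surjective q)
    (f : (free p hp).V →ₗ⁅K,(free p hp).L⁆ D.comap (free p hp).proj) :
    ∃ h : (free p hp).V →ₗ⁅K,(free p hp).L⁆ B.comap (free p hp).proj, ∀ v, q (h v) = f v := by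
  obtain ⟨F, hF, hq⟩ := CrossedModule.exists_free_lift (Subtype.val : p.ker → L) p (fun y => y.2)
    q hq f.toLinearMap fun x m => f.map_lie x m
  exact ⟨⟨F, fun {x m} => hF x m⟩, hq⟩

end

/-- Maps out of a crossed module with free Lie algebra are unique up to homotopy. -/
theorem exists_homotopy {X : Type u} {C C' : CrossedModuleOver K g}
    (e : FreeLieAlgebra K X →ₗ⁅K⁆ C.L) (e' : C.L →ₗ⁅K⁆ FreeLieAlgebra K X) (hee : ∀ x, e (e' x) = x)
    (φ φ' : CrossedModule.Hom C.toCrossedModule C'.toCrossedModule)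
    (hφ : ∀ x, C'.proj (φ.onL x) = C.proj x) (hφ' : ∀ x, C'.proj (φ'.onL x) = C.proj x) :
    ∃ h : C.V →ₗ⁅K,C.L⁆ C'.kerMod.comap C.proj,
      ∀ v, C.bd v = 0 → C'.kerIncl (h v) = φ.onV v - φ'.onV v := by
  obtain ⟨d₀, hd₀, hd₀'⟩ := C'.toCrossedModule.exists_twisted_derivation (φ.onL.comp e)
    (φ'.onL.comp e) fun x => (C'.exact_bd_proj _).1 (by
      rw [map_sub, LieHom.comp_apply, LieHom.comp_apply, hφ, hφ', sub_self])
  -- The derivation lives on the free Lie algebra and is transported to `C.L` along the section `e'`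
  -- of `e`.
  let d : C.L →ₗ[K] C'.V := d₀.comp (e' : C.L →ₗ[K] FreeLieAlgebra K X)
  have hd (x) : C'.bd (d x) = φ.onL x - φ'.onL x := by
    refine (hd₀ (e' x)).trans ?_
    rw [LieHom.comp_apply, LieHom.comp_apply, hee]
  have hd' (x y) : d ⁅x, y⁆ = ⁅φ.onL x, d y⁆ - ⁅φ'.onL y, d x⁆ := by
    change d₀ (e' _) = _
    rw [LieHom.map_lie, hd₀', LieHom.comp_apply, LieHom.comp_apply, hee, hee]
    rfl
  have hk (v) : C'.bd (φ.onV v - φ'.onV v - d (C.bd v)) = 0 := by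
    rw [map_sub, map_sub, φ.comm, φ'.comm, hd, sub_self]
  -- The correction `d ∂` forces the values into `ker ∂` and vanishes on `ker ∂`, where the homotopy
  -- must equal the difference of the two maps.
  refine ⟨⟨⟨⟨fun v => ⟨φ.onV v - φ'.onV v - d (C.bd v), hk v⟩, fun v w => Subtype.ext ?_⟩,
    fun t v => Subtype.ext ?_⟩, fun {x v} => Subtype.ext ?_⟩, fun v hv => ?_⟩
  · change φ.onV (v + w) - φ'.onV (v + w) - d (C.bd (v + w)) =
      (φ.onV v - φ'.onV v - d (C.bd v)) + (φ.onV w - φ'.onV w - d (C.bd w))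
    simp only [map_add]
    abel
  · change φ.onV (t • v) - φ'.onV (t • v) - d (C.bd (t • v)) =
      t • (φ.onV v - φ'.onV v - d (C.bd v))
    simp only [map_smul, smul_sub]
  · change φ.onV ⁅x, v⁆ - φ'.onV ⁅x, v⁆ - d (C.bd ⁅x, v⁆) = _
    refine Eq.trans ?_ ((congrArg (fun z => (⁅z, (⟨_, hk v⟩ :
      LinearMap.ker C'.bd.toLinearMap)⁆ : LinearMap.ker C'.bd.toLinearMap).1) (hφ x).symm).trans
        (C'.coe_lie_ker (φ.onL x) ⟨_, hk v⟩)).symm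
    -- This term comes from the twist in `d ⁅x, ∂ v⁆`; it replaces the action of `φ' x` on `φ' v` by
    -- that of `φ x`, which makes the homotopy linear over `L`.
    have h1 : ⁅φ'.onL (C.bd v), d x⁆ = -⁅φ.onL x, φ'.onV v⁆ + ⁅φ'.onL x, φ'.onV v⁆ := by
      rw [← φ'.comm, C'.skew, hd, sub_lie]
      abel
    rw [φ.map_lie, φ'.map_lie, LieModuleHom.map_lie, hd', h1, lie_sub, lie_sub]
    abel
  · change φ.onV v - φ'.onV v - d (C.bd v) = _
    rw [hv, map_zero, sub_zero]

/-- The free crossed module over the free Lie algebra on the set `g` serves: maps exist because both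
of its terms are free, homotopies because the Lie algebra is free, and lifts because its first term
is free. -/
theorem exists_isProjective : ∃ C : CrossedModuleOver K g, C.IsProjective := by
  let p : FreeLieAlgebra K g →ₗ⁅K⁆ g := FreeLieAlgebra.lift K id
  have hp : Function.Surjective p := fun z =>
    ⟨FreeLieAlgebra.of K z, FreeLieAlgebra.lift_of_apply (R := K) id z⟩
  refine ⟨free p hp, ⟨fun C => ?_, fun C φ φ' hφ hφ' => ?_, free_lift p hp⟩⟩
  · let β : FreeLieAlgebra K g →ₗ⁅K⁆ C.L :=
      FreeLieAlgebra.lift K (Function.surjInv C.proj_surjective)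
    have hβ : C.proj.comp β = p := FreeLieAlgebra.hom_ext fun z => by
      rw [LieHom.comp_apply, FreeLieAlgebra.lift_of_apply, FreeLieAlgebra.lift_of_apply,
        Function.surjInv_eq C.proj_surjective]
      rfl
    exact free_exists_hom p hp C β fun x => LieHom.congr_fun hβ x
  · exact exists_homotopy (C := free p hp) (LieHom.id : FreeLieAlgebra K g →ₗ⁅K⁆ _) LieHom.id
      (fun _ => rfl) φ φ' hφ hφ'

end CrossedModuleOver

/-! ### Morphisms of crossed sequences and the comparison theorem -/

namespace LieMod

variable {K g : Type u} [Field K] [LieRing g] [LieAlgebra K g]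

/-- The canonical map `C → pushout f h`. -/
def pushoutInr {A B C : LieMod K g} (f : A →ₗ⁅K,g⁆ B) (h : A →ₗ⁅K,g⁆ C) :
    C →ₗ⁅K,g⁆ pushout f h where
  toFun c := pushoutMk f h (0, c)
  map_add' b c := by
    rw [← map_add]; exact congrArg _ (Prod.ext (add_zero _).symm rfl)
  map_smul' t c := by
    rw [RingHom.id_apply, ← map_smul]; exact congrArg _ (Prod.ext (smul_zero t).symm rfl)
  map_lie' {x c} := by
    rw [← LieModuleHom.map_lie]; exact congrArg _ (Prod.ext (lie_zero x).symm rfl)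

theorem pushoutInr_apply {A B C : LieMod K g} (f : A →ₗ⁅K,g⁆ B) (h : A →ₗ⁅K,g⁆ C) (a : A) :
    pushoutInr f h (h a) = pushoutInl f h (f a) := by
  refine pushoutMk_congr f h (-a) ?_ ?_
  · rw [map_neg]; exact zero_sub _
  · rw [map_neg, neg_neg]; exact sub_zero _

/-- The diagonal of a module. -/
def diag (A : LieMod K g) : A →ₗ⁅K,g⁆ A.prod A where
  toFun a := (a, a)
  map_add' _ _ := rfl
  map_smul' _ _ := rfl
  map_lie' := rfl

end LieMod

namespace CrossedSeq

variable {K g : Type u} [Field K] [LieRing g] [LieAlgebra K g] {k : ℕ}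

theorem MorOver.comp {A B D : LieMod K g} {α : A →ₗ⁅K,g⁆ B} {β : B →ₗ⁅K,g⁆ D}
    {S : CrossedSeq K g k A} {T : CrossedSeq K g k B} {U : CrossedSeq K g k D}
    (h' : MorOver β T U) (h : MorOver α S T) : MorOver (β.comp α) S U := by
  induction S generalizing B D with
  | crossed C ι =>
    cases T with
    | crossed C' ι' =>
    cases U with
    | crossed C'' ι'' =>
      obtain ⟨φ, h1, h2⟩ := h
      obtain ⟨ψ, h3, h4⟩ := h'
      refine ⟨⟨ψ.onV.comp φ.onV, ψ.onL.comp φ.onL, fun v => ?_, fun x v => ?_⟩, fun x => ?_,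
        fun a => ?_⟩
      · exact (ψ.comm _).trans (congrArg ψ.onL (φ.comm v))
      · exact (congrArg ψ.onV (φ.map_lie x v)).trans (ψ.map_lie _ _)
      · exact (h3 _).trans (h1 x)
      · exact (congrArg ψ.onV (h2 a)).trans (h4 _)
  | cons X f S ih =>
    cases T with
    | cons X' f' T =>
    cases U with
    | cons X'' f'' U =>
      obtain ⟨φ, h1, h2⟩ := h
      obtain ⟨ψ, h3, h4⟩ := h'
      exact ⟨ψ.comp φ, fun a => (congrArg ψ (h1 a)).trans (h3 _), ih h4 h2⟩

/-- The canonical morphism to the pushout. -/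
theorem morOver_pushforward {A B : LieMod K g} (α : A →ₗ⁅K,g⁆ B) (S : CrossedSeq K g k A)
    (h : S.IsExact) : MorOver α S (S.pushforward α h) := by
  cases S with
  | crossed C ι =>
    let r := LieMod.pushoutInr (LieMod.comapHom C.proj α) ι
    exact ⟨⟨r.toLinearMap, LieHom.id, fun v => zero_add (C.bd v), fun x v => r.map_lie x v⟩,
      fun _ => rfl, LieMod.pushoutInr_apply _ ι⟩
  | cons X f S =>
    refine ⟨LieMod.pushoutInr α f, LieMod.pushoutInr_apply α f, ?_⟩
    cases S with
    | crossed C ι =>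
      exact ⟨⟨LinearMap.id, LieHom.id, fun _ => rfl, fun _ _ => rfl⟩, fun _ => rfl,
        fun x => (zero_add (ι x)).symm⟩
    | cons Y e S => exact ⟨LieModuleHom.id, fun x => (zero_add (e x)).symm, .refl S⟩

/-- Needed for additivity in `γ`, since `γ + γ'` is the composite of the diagonal, `γ ⊕ γ'` and the
codiagonal. -/
theorem morOver_diag {A : LieMod K g} (S : CrossedSeq K g k A) :
    MorOver A.diag S (S.sum S) := by
  induction S with
  | crossed C ι =>
    exact ⟨⟨LinearMap.prod LinearMap.id LinearMap.id,
      { toFun := fun x => ⟨(x, x), rfl⟩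
        map_add' := fun _ _ => rfl
        map_smul' := fun _ _ => rfl
        map_lie' := rfl }, fun _ => rfl, fun _ _ => rfl⟩, fun _ => rfl, fun _ => rfl⟩
  | cons X f S ih => exact ⟨X.diag, fun _ => rfl, ih⟩

theorem morOver_null {A B : LieMod K g} (α : A →ₗ⁅K,g⁆ B) (S : CrossedSeq K g k A) :
    MorOver α S (null k B) := by
  induction S generalizing B with
  | crossed C ι =>
    exact ⟨⟨0, C.proj, fun v => (C.exact_bd_proj.apply_apply_eq_zero v).symm, fun _ _ => rfl⟩,
      fun _ => rfl, fun _ => rfl⟩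
  | cons X f S ih => exact ⟨0, fun _ => rfl, ih _⟩

theorem morOver_precomp_neg {A : LieMod K g} (S : CrossedSeq K g k A) :
    MorOver (-LieModuleHom.id) S (S.precomp (-LieModuleHom.id)) := by
  have h : MorOver (-LieModuleHom.id) (S.precomp LieModuleHom.id)
      (S.precomp (-LieModuleHom.id)) := by
    refine (MorOver.refl S).precomp fun a => ?_
    change a = - -a
    rw [neg_neg]
  cases S <;> exact h

/-- The map `γ` out of the leftmost term extends along the leftmost map of the sequence. -/
def Extends : {k : ℕ} → {A B : LieMod K g} → CrossedSeq K g k A → (A →ₗ⁅K,g⁆ B) → Prop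
  | _, _, B, crossed C ι, γ => ∃ h : C.V →ₗ⁅K,C.L⁆ B.comap C.proj, ∀ a, h (ι a) = γ a
  | _, _, B, cons X f _, γ => ∃ h : X →ₗ⁅K,g⁆ B, ∀ a, h (f a) = γ a

theorem Extends.add {A B : LieMod K g} {S : CrossedSeq K g k A} {γ γ' : A →ₗ⁅K,g⁆ B}
    (h : S.Extends γ) (h' : S.Extends γ') : S.Extends (γ + γ') := by
  cases S with
  | crossed C ι =>
    obtain ⟨h, hh⟩ := h
    obtain ⟨h', hh'⟩ := h'
    exact ⟨h + h', fun a => congrArg₂ (fun x y : B => x + y) (hh a) (hh' a)⟩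
  | cons X f S =>
    obtain ⟨h, hh⟩ := h
    obtain ⟨h', hh'⟩ := h'
    exact ⟨h + h', fun a => congrArg₂ (· + ·) (hh a) (hh' a)⟩

theorem Extends.zero {A B : LieMod K g} (S : CrossedSeq K g k A) :
    S.Extends (0 : A →ₗ⁅K,g⁆ B) := by
  cases S <;> exact ⟨0, fun _ => rfl⟩

/-- The extension of `γ` is the component at the copy of `B` next to the leftmost term; beyond it
the target is zero up to `g`. -/
theorem Extends.morOver_zero {A B : LieMod K g} {S : CrossedSeq K g k A} {γ : A →ₗ⁅K,g⁆ B}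
    (h : S.Extends γ) : MorOver γ S (CrossedSeq.zero k B) := by
  cases S with
  | crossed C ι =>
    obtain ⟨h, hh⟩ := h
    exact ⟨⟨h.toLinearMap, C.proj, fun v => (C.exact_bd_proj.apply_apply_eq_zero v).symm,
      fun x v => h.map_lie x v⟩, fun _ => rfl, hh⟩
  | cons X f S =>
    obtain ⟨h, hh⟩ := h
    exact ⟨h, hh, morOver_null _ _⟩

/-- All terms of the sequence, apart from the leftmost one, are projective. -/
def IsProjective : {k : ℕ} → {A : LieMod K g} → CrossedSeq K g k A → Prop
  | _, _, crossed C _ => C.IsProjective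
  | _, _, cons X _ S => X.IsProjective ∧ S.IsProjective

theorem IsProjective.precomp {A B : LieMod K g} (γ : B →ₗ⁅K,g⁆ A) {S : CrossedSeq K g k A}
    (h : S.IsProjective) : (S.precomp γ).IsProjective := by
  cases S <;> exact h

/-- Extensions to a projective first term lift along surjections. -/
theorem IsProjective.extends_lift {A B D : LieMod K g} {S : CrossedSeq K g k A}
    (hS : S.IsProjective) (q : B →ₗ⁅K,g⁆ D) (hq : Function.Surjective q) {γ : A →ₗ⁅K,g⁆ D}
    (h : S.Extends γ) : ∃ ε : A →ₗ⁅K,g⁆ B, S.Extends ε ∧ ∀ a, q (ε a) = γ a := by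
  cases S with
  | crossed C ι =>
    obtain ⟨h, hh⟩ := h
    obtain ⟨l, hl⟩ := CrossedModuleOver.IsProjective.lift hS B D q hq h
    exact ⟨LieMod.ofComap C.proj_surjective (l.comp ι), ⟨l, fun _ => rfl⟩,
      fun a => (hl (ι a)).trans (hh a)⟩
  | cons X f S =>
    obtain ⟨h, hh⟩ := h
    obtain ⟨l, hl⟩ := hS.1 B D q h fun _ => hq _
    exact ⟨l.comp f, ⟨l, fun _ => rfl⟩, fun a => (hl (f a)).trans (hh a)⟩

theorem MorOver.map_firstKer {A A' : LieMod K g} {α : A →ₗ⁅K,g⁆ A'} {S : CrossedSeq K g k A}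
    {S' : CrossedSeq K g k A'} (h : MorOver α S S') {a : A} (ha : a ∈ S.firstKer) :
    α a ∈ S'.firstKer := by
  cases S with
  | crossed C ι =>
    cases S' with
    | crossed C' ι' =>
      obtain ⟨φ, _, h2⟩ := h
      have ha : ι a = 0 := ha
      exact (h2 a).symm.trans ((congrArg φ.onV ha).trans (map_zero φ.onV))
  | cons X f S =>
    cases S' with
    | cons X' f' S' =>
      obtain ⟨φ, h1, _⟩ := h
      have ha : f a = 0 := ha
      exact (h1 a).symm.trans ((congrArg φ ha).trans (map_zero φ))

/-- Comparison: a projective sequence maps to every exact sequence, provided the leftmost term can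
be lifted. -/
theorem IsProjective.exists_morOver {A A' : LieMod K g} {S : CrossedSeq K g k A}
    {S' : CrossedSeq K g k A'} (hS : S.IsProjective) (hSe : S.IsExact) (hS' : S'.IsExact)
    (h : A.IsProjective ∨ S'.firstKer = ⊥) : ∃ γ : A →ₗ⁅K,g⁆ A', MorOver γ S S' := by
  induction S generalizing A' with
  | crossed C ι =>
    cases S' with
    | crossed C' ι' =>
      obtain ⟨φ, hφ⟩ := CrossedModuleOver.IsProjective.exists_hom hS C'
      obtain ⟨γ, hγ⟩ := LieMod.exists_lift (C'.toKer ι' hS'.apply_apply_eq_zero)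
        ((CrossedModuleOver.kerMap φ hφ).comp (C.toKer ι hSe.apply_apply_eq_zero))
        (h.imp_right fun h => by
          rw [injective_iff_map_eq_zero]
          intro a ha
          exact (Submodule.mem_bot K).1 (h ▸ congrArg Subtype.val ha))
        fun a => by
          obtain ⟨b, hb⟩ := (hS' _).1 ((CrossedModuleOver.kerMap φ hφ).comp
            (C.toKer ι hSe.apply_apply_eq_zero) a).2
          exact ⟨b, Subtype.ext hb⟩
      exact ⟨γ, φ, hφ, fun a => (congrArg Subtype.val (hγ a)).symm⟩
  | cons X f S ih =>
    cases S' with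
    | cons X' f' S' =>
      -- Inner terms lift because they are projective; injectivity of the first map of `S'` can only
      -- matter at the leftmost term.
      obtain ⟨φ, hφ⟩ := ih hS.2 hSe.2 hS'.2 (Or.inl hS.1)
      obtain ⟨γ, hγ⟩ := LieMod.exists_lift f' (φ.comp f)
        (h.imp_right fun h => LinearMap.ker_eq_bot.1 h) fun a => by
          have h1 : f a ∈ S.firstKer := hSe.1 ▸ LinearMap.mem_range_self f.toLinearMap a
          have h2 := hφ.map_firstKer h1
          rw [← hS'.1] at h2
          exact h2
      exact ⟨γ, φ, fun a => (hγ a).symm, hφ⟩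

/-- Uniqueness in the comparison: two morphisms out of a projective sequence are homotopic. -/
theorem IsProjective.exists_extends {A A' : LieMod K g} {S : CrossedSeq K g k A}
    {S' : CrossedSeq K g k A'} (hS : S.IsProjective) (hSe : S.IsExact) (hS' : S'.IsExact)
    {γ γ' : A →ₗ⁅K,g⁆ A'} (h : MorOver γ S S') (h' : MorOver γ' S S') :
    ∃ ε : A →ₗ⁅K,g⁆ A', S.Extends ε ∧ ∀ a, γ a - γ' a - ε a ∈ S'.firstKer := by
  induction S generalizing A' with
  | crossed C ι =>
    cases S' with
    | crossed C' ι' =>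
      obtain ⟨φ, h1, h2⟩ := h
      obtain ⟨φ', h1', h2'⟩ := h'
      obtain ⟨l, hl⟩ := CrossedModuleOver.IsProjective.homotopy hS C' φ φ' h1 h1'
      -- By exactness `A'` surjects onto `ker ∂'`, so the homotopy, which takes values there, lifts
      -- to `A'`.
      obtain ⟨m, hm⟩ := CrossedModuleOver.IsProjective.lift hS _ _
        (C'.toKer ι' hS'.apply_apply_eq_zero) (fun v => by
          obtain ⟨b, hb⟩ := (hS' v.1).1 v.2
          exact ⟨b, Subtype.ext hb⟩) l
      let ε : _ →ₗ⁅K,g⁆ A' := LieMod.ofComap C.proj_surjective (m.comp ι)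
      refine ⟨ε, ⟨m, fun _ => rfl⟩, fun a => ?_⟩
      have h3 : ι' (ε a) = φ.onV (ι a) - φ'.onV (ι a) :=
        (congrArg Subtype.val (hm (ι a))).trans (hl _ (hSe.apply_apply_eq_zero a))
      change ι' (γ a - γ' a - ε a) = 0
      refine (map_sub ι' _ _).trans (sub_eq_zero.2 ?_)
      exact (map_sub ι' _ _).trans ((congrArg₂ (· - ·) (h2 a) (h2' a)).symm.trans h3.symm)
  | cons X f S ih =>
    cases S' with
    | cons X' f' S' =>
      obtain ⟨φ, h1, h2⟩ := h
      obtain ⟨φ', h1', h2'⟩ := h'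
      obtain ⟨ε, hε, hε'⟩ := ih hS.2 hSe.2 hS'.2 h2 h2'
      -- The map `ε` factors through the first map of `S`, which kills the image of `f`.
      have hf (a) : ε (f a) = 0 := by
        have h3 : f a ∈ S.firstKer := hSe.1 ▸ LinearMap.mem_range_self f.toLinearMap a
        cases S with
        | crossed C ι =>
          obtain ⟨l, hl⟩ := hε
          exact (hl (f a)).symm.trans ((congrArg l h3).trans (map_zero l))
        | cons Y e S =>
          obtain ⟨l, hl⟩ := hε
          exact (hl (f a)).symm.trans ((congrArg l h3).trans (map_zero l))
      -- The next component of the homotopy: `φ - φ' - ε` lands in the range of `f'` by exactness,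
      -- and `X` is projective.
      obtain ⟨l, hl⟩ := hS.1 A' X' f' (φ - φ' - ε) fun x => by
        have h3 := hε' x
        rw [← hS'.1] at h3
        exact h3
      refine ⟨l.comp f, ⟨l, fun _ => rfl⟩, fun a => ?_⟩
      change f' (γ a - γ' a - l (f a)) = 0
      rw [map_sub, map_sub, hl, ← h1, ← h1']
      change φ (f a) - φ' (f a) - (φ (f a) - φ' (f a) - ε (f a)) = 0
      rw [hf, sub_zero, sub_self]

end CrossedSeq

namespace CrossedExt

variable {K g : Type u} [Field K] [LieRing g] [LieAlgebra K g] {k : ℕ}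

theorem morOver_baerSum {M : LieMod K g} (E E' : CrossedExt K g k M) :
    CrossedSeq.MorOver M.codiag (E.sum E').seq (E.baerSum E').seq :=
  CrossedSeq.morOver_pushforward _ _ _

/-- A morphism of short exact sequences and a compatible morphism of extensions induce a morphism of
the spliced extensions. -/
theorem morOver_splice {A A' A'' B B' B'' : LieMod K g} {α : A →ₗ⁅K,g⁆ A'} {β : A' →ₗ⁅K,g⁆ A''}
    {hα : Function.Injective α} {hαβ : Function.Exact α β} {hβ : Function.Surjective β}
    {α' : B →ₗ⁅K,g⁆ B'} {β' : B' →ₗ⁅K,g⁆ B''}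
    {hα' : Function.Injective α'} {hαβ' : Function.Exact α' β'} {hβ' : Function.Surjective β'}
    {γ : A →ₗ⁅K,g⁆ B} {γ' : A' →ₗ⁅K,g⁆ B'} {γ'' : A'' →ₗ⁅K,g⁆ B''}
    (h : ∀ a, γ' (α a) = α' (γ a)) (h' : ∀ a, γ'' (β a) = β' (γ' a))
    {E : CrossedExt K g k A''} {E' : CrossedExt K g k B''}
    (hE : CrossedSeq.MorOver γ'' E.seq E'.seq) :
    CrossedSeq.MorOver γ (E.splice α β hα hαβ hβ).seq (E'.splice α' β' hα' hαβ' hβ').seq :=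
  ⟨γ', h, hE.precomp h'⟩

/-- One degree is gained by splicing with `0 → ker → cover Z → Z → 0`, whose middle term is free. -/
theorem exists_isProjective (k : ℕ) :
    ∃ (Z : LieMod K g) (U : CrossedExt K g k Z), U.seq.IsProjective := by
  induction k with
  | zero =>
    obtain ⟨C, hC⟩ := CrossedModuleOver.exists_isProjective (K := K) (g := g)
    exact ⟨C.kerMod, ⟨.crossed C C.kerIncl, LinearMap.ker_eq_bot.2 C.kerIncl_injective,
      C.exact_kerIncl⟩, hC⟩
  | succ k ih =>
    obtain ⟨Z, U, hU⟩ := ih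
    exact ⟨_, U.splice (LieMod.kernelIncl Z.coverMap) Z.coverMap (LieMod.kernelIncl_injective _)
      (LieMod.exact_kernelIncl _) Z.coverMap_surjective, Z.isProjective_cover, hU.precomp _⟩

end CrossedExt

/-! ### `Opext` as a quotient of `Hom(Z, M)` -/

namespace Opext

variable {K g : Type u} [Field K] [LieRing g] [LieAlgebra K g] {k : ℕ}

/-- A morphism over `α` factors through the pushout `α_* E`. Functoriality of the pushforward gives
this up to replacing `E'` by its pushforward along the identity, which is equivalent to `E'`. -/
theorem mk_eq_map {M N : LieMod K g} {α : M →ₗ⁅K,g⁆ N} {E : CrossedExt K g k M}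
    {E' : CrossedExt K g k N} (h : CrossedSeq.MorOver α E.seq E'.seq) :
    (Quot.mk _ E' : Opext K g k N) = map k α (Quot.mk _ E) := by
  have h1 : (E.pushforward α).Rel (E'.pushforward LieModuleHom.id) :=
    CrossedSeq.MorOver.pushforward (β := LieModuleHom.id) (fun _ => rfl) E.isExact E'.isExact h
  have h2 : E'.Rel (E'.pushforward LieModuleHom.id) :=
    CrossedSeq.morOver_pushforward LieModuleHom.id E'.seq E'.isExact
  exact (Quot.sound h2).trans (Quot.sound h1).symm

section Representable

variable {Z : LieMod K g} (U : CrossedExt K g k Z)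

/-- The class of the extension of `g` by `M` obtained from `U` along `γ`. -/
def ofHom {M : LieMod K g} (γ : Z →ₗ⁅K,g⁆ M) : Opext K g k M := map k γ (Quot.mk _ U)

variable {U}

theorem mk_eq_ofHom {M : LieMod K g} {γ : Z →ₗ⁅K,g⁆ M} {E : CrossedExt K g k M}
    (h : CrossedSeq.MorOver γ U.seq E.seq) : (Quot.mk _ E : Opext K g k M) = ofHom U γ :=
  mk_eq_map h

theorem map_ofHom {M N : LieMod K g} (α : M →ₗ⁅K,g⁆ N) (γ : Z →ₗ⁅K,g⁆ M) :
    map k α (ofHom U γ) = ofHom U (α.comp γ) :=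
  mk_eq_ofHom (E := (U.pushforward γ).pushforward α)
    ((CrossedSeq.morOver_pushforward α _ (U.pushforward γ).isExact).comp
      (CrossedSeq.morOver_pushforward γ _ U.isExact))

theorem ofHom_add {M : LieMod K g} (γ γ' : Z →ₗ⁅K,g⁆ M) :
    ofHom U γ + ofHom U γ' = ofHom U (γ + γ') := by
  refine mk_eq_ofHom (E := (U.pushforward γ).baerSum (U.pushforward γ')) ?_
  exact (CrossedExt.morOver_baerSum (U.pushforward γ) (U.pushforward γ')).comp
    ((CrossedSeq.MorOver.sum (CrossedSeq.morOver_pushforward γ _ U.isExact)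
      (CrossedSeq.morOver_pushforward γ' _ U.isExact)).comp (CrossedSeq.morOver_diag U.seq))

theorem ofHom_of_extends {M : LieMod K g} {γ : Z →ₗ⁅K,g⁆ M} (h : U.seq.Extends γ) :
    ofHom U γ = 0 :=
  (mk_eq_ofHom (E := CrossedExt.zero k M) h.morOver_zero).symm

theorem ofHom_zero {M : LieMod K g} : ofHom U (0 : Z →ₗ⁅K,g⁆ M) = 0 :=
  ofHom_of_extends (.zero _)

theorem neg_ofHom {M : LieMod K g} (γ : Z →ₗ⁅K,g⁆ M) : -ofHom U γ = ofHom U (-γ) := by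
  have h : CrossedSeq.MorOver (-LieModuleHom.id) (U.pushforward γ).seq
      (U.pushforward γ).neg.seq :=
    CrossedSeq.morOver_precomp_neg _
  refine (mk_eq_map h).trans ?_
  refine (map_ofHom _ γ).trans (congrArg _ ?_)
  ext z
  rfl

/-- A morphism of short exact sequences computes the connecting map. -/
theorem connecting_ofHom {Z' X M M' M'' : LieMod K g} {i : Z' →ₗ⁅K,g⁆ X} {q : X →ₗ⁅K,g⁆ Z}
    (hi : Function.Injective i) (hiq : Function.Exact i q) (hq : Function.Surjective q)
    {α : M →ₗ⁅K,g⁆ M'} {β : M' →ₗ⁅K,g⁆ M''}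
    (hα : Function.Injective α) (hαβ : Function.Exact α β) (hβ : Function.Surjective β)
    {γ' : Z' →ₗ⁅K,g⁆ M} {h : X →ₗ⁅K,g⁆ M'} {γ : Z →ₗ⁅K,g⁆ M''}
    (h₁ : ∀ z, h (i z) = α (γ' z)) (h₂ : ∀ x, γ (q x) = β (h x)) :
    connecting k α β hα hαβ hβ (ofHom U γ) = ofHom (U.splice i q hi hiq hq) γ' :=
  mk_eq_ofHom (E := (U.pushforward γ).splice α β hα hαβ hβ)
    (CrossedExt.morOver_splice h₁ h₂ (CrossedSeq.morOver_pushforward γ _ U.isExact))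

theorem exists_eq_ofHom (hU : U.seq.IsProjective) {M : LieMod K g} (x : Opext K g k M) :
    ∃ γ, x = ofHom U γ := by
  obtain ⟨E, rfl⟩ := Quot.exists_rep x
  obtain ⟨γ, hγ⟩ := hU.exists_morOver U.isExact E.isExact (Or.inr E.firstKer_eq_bot)
  exact ⟨γ, mk_eq_ofHom hγ⟩

/-- The error left by the homotopy lies in the kernel of `M → M_{k+1}`, or of `M → M_1` if `k = 0`,
and this is zero. -/
theorem extends_sub (hU : U.seq.IsProjective) {M : LieMod K g} {E : CrossedExt K g k M}
    {γ γ' : Z →ₗ⁅K,g⁆ M} (h : CrossedSeq.MorOver γ U.seq E.seq)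
    (h' : CrossedSeq.MorOver γ' U.seq E.seq) : U.seq.Extends (γ - γ') := by
  obtain ⟨ε, hε, hε'⟩ := hU.exists_extends U.isExact E.isExact h h'
  convert hε
  ext z
  have h1 := hε' z
  rw [E.firstKer_eq_bot, Submodule.mem_bot] at h1
  exact sub_eq_zero.1 h1

/-- For projective `U`, the maps `γ` such that the class is the one obtained from `U` along `γ`. -/
def homs (hU : U.seq.IsProjective) {M : LieMod K g} (x : Opext K g k M) : Set (Z →ₗ⁅K,g⁆ M) :=
  Quot.lift (fun E => {γ | ∃ γ', CrossedSeq.MorOver γ' U.seq E.seq ∧ U.seq.Extends (γ - γ')})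
    -- Invariance is needed only along a generating morphism `E → E'`. Composition transports `γ'`
    -- forwards; backwards, a new morphism to `E` is chosen and compared with `γ'` over `E'`.
    (fun E E' h => by
      ext γ
      constructor
      · rintro ⟨γ', h1, h2⟩
        exact ⟨γ', h.comp h1, h2⟩
      · rintro ⟨γ', h1, h2⟩
        obtain ⟨γ'', h3⟩ := hU.exists_morOver U.isExact E.isExact (Or.inr E.firstKer_eq_bot)
        refine ⟨γ'', h3, ?_⟩
        rw [← sub_add_sub_cancel γ γ' γ'']
        exact h2.add (extends_sub hU h1 (h.comp h3))) x

/-- If the class vanishes, the invariant `homs` places `γ` among the maps belonging to the zero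
extension, which also receives a morphism over `0`; so `γ` differs from `0` by extendable maps. -/
theorem ofHom_eq_zero_iff (hU : U.seq.IsProjective) {M : LieMod K g} {γ : Z →ₗ⁅K,g⁆ M} :
    ofHom U γ = 0 ↔ U.seq.Extends γ := by
  refine ⟨fun h => ?_, ofHom_of_extends⟩
  have h1 : γ ∈ homs hU (ofHom U γ) := by
    refine ⟨γ, CrossedSeq.morOver_pushforward γ _ U.isExact, ?_⟩
    rw [sub_self]
    exact .zero _
  rw [h] at h1
  obtain ⟨γ', h2, h3⟩ := h1
  have h4 := extends_sub (E := CrossedExt.zero k M) hU h2 (CrossedSeq.Extends.zero _).morOver_zero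
  rw [sub_zero] at h4
  rw [← sub_add_cancel γ γ']
  exact h3.add h4

end Representable

/-! ### Group laws, inherited from the addition of maps out of `Z` -/

section Group

variable {M : LieMod K g}

theorem add_assoc (x y z : Opext K g k M) : x + y + z = x + (y + z) := by
  obtain ⟨Z, U, hU⟩ := CrossedExt.exists_isProjective (K := K) (g := g) k
  obtain ⟨γ₁, rfl⟩ := exists_eq_ofHom hU x
  obtain ⟨γ₂, rfl⟩ := exists_eq_ofHom hU y
  obtain ⟨γ₃, rfl⟩ := exists_eq_ofHom hU z
  simp only [ofHom_add, _root_.add_assoc]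

theorem add_comm (x y : Opext K g k M) : x + y = y + x := by
  obtain ⟨Z, U, hU⟩ := CrossedExt.exists_isProjective (K := K) (g := g) k
  obtain ⟨γ₁, rfl⟩ := exists_eq_ofHom hU x
  obtain ⟨γ₂, rfl⟩ := exists_eq_ofHom hU y
  rw [ofHom_add, ofHom_add, _root_.add_comm]

theorem zero_add (x : Opext K g k M) : 0 + x = x := by
  obtain ⟨Z, U, hU⟩ := CrossedExt.exists_isProjective (K := K) (g := g) k
  obtain ⟨γ, rfl⟩ := exists_eq_ofHom hU x
  rw [← ofHom_zero (U := U), ofHom_add, _root_.zero_add]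

theorem neg_add_cancel (x : Opext K g k M) : -x + x = 0 := by
  obtain ⟨Z, U, hU⟩ := CrossedExt.exists_isProjective (K := K) (g := g) k
  obtain ⟨γ, rfl⟩ := exists_eq_ofHom hU x
  rw [neg_ofHom, ofHom_add, _root_.neg_add_cancel, ofHom_zero]

theorem map_add {N : LieMod K g} (α : M →ₗ⁅K,g⁆ N) (x y : Opext K g k M) :
    map k α (x + y) = map k α x + map k α y := by
  obtain ⟨Z, U, hU⟩ := CrossedExt.exists_isProjective (K := K) (g := g) k
  obtain ⟨γ₁, rfl⟩ := exists_eq_ofHom hU x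
  obtain ⟨γ₂, rfl⟩ := exists_eq_ofHom hU y
  rw [ofHom_add, map_ofHom, map_ofHom, map_ofHom, ofHom_add]
  congr 1
  ext z
  exact α.map_add _ _

end Group

/-! ### Exactness of the long sequence -/

section Exact

variable {M M' M'' : LieMod K g} (α : M →ₗ⁅K,g⁆ M') (β : M' →ₗ⁅K,g⁆ M'')

/-- A projective extension by `Z` whose splice with a cover of `Z` is projective as well. -/
theorem exists_resolution (k : ℕ) :
    ∃ (Z : LieMod K g) (U : CrossedExt K g k Z) (Z' X : LieMod K g) (i : Z' →ₗ⁅K,g⁆ X)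
      (q : X →ₗ⁅K,g⁆ Z) (hi : Function.Injective i) (hiq : Function.Exact i q)
      (hq : Function.Surjective q), U.seq.IsProjective ∧ X.IsProjective ∧
        (U.splice i q hi hiq hq).seq.IsProjective := by
  obtain ⟨Z, U, hU⟩ := CrossedExt.exists_isProjective (K := K) (g := g) k
  exact ⟨Z, U, _, _, LieMod.kernelIncl Z.coverMap, Z.coverMap, LieMod.kernelIncl_injective _,
    LieMod.exact_kernelIncl _, Z.coverMap_surjective, hU, Z.isProjective_cover,
    Z.isProjective_cover, hU.precomp _⟩

/-- A map out of `Z` to `M''` extends to a morphism of short exact sequences. -/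
theorem exists_ladder (hα : Function.Injective α) (hαβ : Function.Exact α β)
    (hβ : Function.Surjective β)
    {Z Z' X : LieMod K g} {i : Z' →ₗ⁅K,g⁆ X} {q : X →ₗ⁅K,g⁆ Z}
    (hiq : Function.Exact i q) (hX : X.IsProjective) (γ : Z →ₗ⁅K,g⁆ M'') :
    ∃ (h : X →ₗ⁅K,g⁆ M') (γ' : Z' →ₗ⁅K,g⁆ M), (∀ z, h (i z) = α (γ' z)) ∧
      ∀ x, γ (q x) = β (h x) := by
  obtain ⟨h, hh⟩ := hX M' M'' β (γ.comp q) fun _ => hβ _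
  obtain ⟨γ', hγ'⟩ := LieMod.exists_lift α (h.comp i) (Or.inr hα) fun z => by
    refine (hαβ _).1 ((hh (i z)).trans ?_)
    exact (congrArg γ (hiq.apply_apply_eq_zero z)).trans (map_zero γ)
  exact ⟨h, γ', fun z => (hγ' z).symm, fun x => (hh x).symm⟩

theorem connecting_add (hα : Function.Injective α) (hαβ : Function.Exact α β)
    (hβ : Function.Surjective β)
    (x y : Opext K g k M'') :
    connecting k α β hα hαβ hβ (x + y) =
      connecting k α β hα hαβ hβ x + connecting k α β hα hαβ hβ y := by
  obtain ⟨Z, U, Z', X, i, q, hi, hiq, hq, hU, hX, -⟩ := exists_resolution (K := K) (g := g) k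
  obtain ⟨γ₁, rfl⟩ := exists_eq_ofHom hU x
  obtain ⟨γ₂, rfl⟩ := exists_eq_ofHom hU y
  obtain ⟨h₁, γ₁', ha₁, hb₁⟩ := exists_ladder α β hα hαβ hβ hiq hX γ₁
  obtain ⟨h₂, γ₂', ha₂, hb₂⟩ := exists_ladder α β hα hαβ hβ hiq hX γ₂
  rw [connecting_ofHom hi hiq hq hα hαβ hβ ha₁ hb₁, connecting_ofHom hi hiq hq hα hαβ hβ ha₂ hb₂,
    ofHom_add, ofHom_add]
  refine connecting_ofHom (h := h₁ + h₂) hi hiq hq hα hαβ hβ (fun z => ?_) fun x => ?_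
  · exact (congrArg₂ (· + ·) (ha₁ z) (ha₂ z)).trans (α.map_add _ _).symm
  · exact (congrArg₂ (· + ·) (hb₁ x) (hb₂ x)).trans (β.map_add _ _).symm

theorem exact_map_map (hα : Function.Injective α) (hαβ : Function.Exact α β)
    (hβ : Function.Surjective β) :
    Function.Exact (map k α) (map k β) := by
  obtain ⟨Z, U, hU⟩ := CrossedExt.exists_isProjective (K := K) (g := g) k
  intro x
  obtain ⟨γ, rfl⟩ := exists_eq_ofHom hU x
  constructor
  · intro hx
    rw [map_ofHom, ofHom_eq_zero_iff hU] at hx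
    -- Changing `γ` by the extendable map `ε` keeps its class and makes `β (γ - ε) = 0`, so `γ - ε`
    -- comes from `M`.
    obtain ⟨ε, hε, hε'⟩ := hU.extends_lift β hβ hx
    obtain ⟨γ', hγ'⟩ := LieMod.exists_lift α (γ - ε) (Or.inr hα) fun z => by
      refine (hαβ _).1 ((map_sub β _ _).trans (sub_eq_zero.2 ?_))
      exact (hε' z).symm
    refine ⟨ofHom U γ', ?_⟩
    have h : α.comp γ' + ε = γ := by
      ext z
      exact (congrArg (· + ε z) (hγ' z)).trans (sub_add_cancel (γ z) (ε z))
    rw [map_ofHom, ← h, ← ofHom_add, ofHom_of_extends hε, add_comm, zero_add]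
  · rintro ⟨y, hy⟩
    obtain ⟨γ', rfl⟩ := exists_eq_ofHom hU y
    rw [← hy, map_ofHom, map_ofHom]
    have h : β.comp (α.comp γ') = 0 := by
      ext z
      exact hαβ.apply_apply_eq_zero _
    rw [h, ofHom_zero]

theorem exact_map_connecting (hα : Function.Injective α) (hαβ : Function.Exact α β)
    (hβ : Function.Surjective β) :
    Function.Exact (map k β) (connecting k α β hα hαβ hβ) := by
  obtain ⟨Z, U, Z', X, i, q, hi, hiq, hq, hU, hX, hU'⟩ := exists_resolution (K := K) (g := g) k
  intro x
  obtain ⟨γ, rfl⟩ := exists_eq_ofHom hU x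
  constructor
  · intro hx
    obtain ⟨h, γ', ha, hb⟩ := exists_ladder α β hα hαβ hβ hiq hX γ
    rw [connecting_ofHom hi hiq hq hα hαβ hβ ha hb, ofHom_eq_zero_iff hU'] at hx
    obtain ⟨l, hl⟩ := hx
    -- Vanishing of the connecting class extends `γ'` to `l : X → M`. Then `h - α l` is another lift
    -- of `γ q`, and it kills `Z'`.
    obtain ⟨δ, hδ⟩ := LieMod.exists_desc q hq (h - α.comp l) fun x hx => by
      obtain ⟨z, rfl⟩ := (hiq x).1 hx
      exact sub_eq_zero.2 ((ha z).trans (congrArg α (hl z).symm))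
    refine ⟨ofHom U δ, (map_ofHom β δ).trans (congrArg _ ?_)⟩
    ext z
    obtain ⟨x, rfl⟩ := hq z
    refine (congrArg β (hδ x)).trans ((map_sub β _ _).trans ?_)
    refine Eq.trans ?_ (hb x).symm
    exact (congrArg (β (h x) - ·) (hαβ.apply_apply_eq_zero (l x))).trans (sub_zero _)
  · rintro ⟨y, hy⟩
    obtain ⟨δ, rfl⟩ := exists_eq_ofHom hU y
    -- A map that factors as `β δ` has the lift `δ q`, which restricts to zero on `Z'`.
    rw [← hy, map_ofHom, connecting_ofHom (γ' := 0) (h := δ.comp q) hi hiq hq hα hαβ hβ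
      (fun z => ?_) fun x => rfl, ofHom_zero]
    refine (congrArg δ (hiq.apply_apply_eq_zero z)).trans ((map_zero δ).trans ?_)
    exact (map_zero α).symm

theorem exact_connecting_map (hα : Function.Injective α) (hαβ : Function.Exact α β)
    (hβ : Function.Surjective β) :
    Function.Exact (connecting k α β hα hαβ hβ) (map (k + 1) α) := by
  obtain ⟨Z, U, Z', X, i, q, hi, hiq, hq, hU, hX, hU'⟩ := exists_resolution (K := K) (g := g) k
  intro x
  constructor
  · intro hx
    obtain ⟨γ', rfl⟩ := exists_eq_ofHom hU' x
    rw [map_ofHom, ofHom_eq_zero_iff hU'] at hx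
    obtain ⟨h, hh⟩ := hx
    -- The extension `h` of `α γ'` to `X` yields the ladder: `β h` kills `Z'`, and the map induced
    -- on `Z` has connecting class `γ'`.
    obtain ⟨γ, hγ⟩ := LieMod.exists_desc q hq (β.comp h) fun x hx => by
      obtain ⟨z, rfl⟩ := (hiq x).1 hx
      exact (congrArg β (hh z)).trans (hαβ.apply_apply_eq_zero _)
    exact ⟨ofHom U γ, connecting_ofHom hi hiq hq hα hαβ hβ hh hγ⟩
  · rintro ⟨y, rfl⟩
    obtain ⟨γ, rfl⟩ := exists_eq_ofHom hU y
    obtain ⟨h, γ', ha, hb⟩ := exists_ladder α β hα hαβ hβ hiq hX γ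
    rw [connecting_ofHom hi hiq hq hα hαβ hβ ha hb, map_ofHom]
    -- In the spliced sequence the term after `Z'` is `X`, so `h` itself is the extension of `α γ'`.
    exact ofHom_of_extends ⟨h, ha⟩

end Exact

end Opext
theorem mainTheorem3 {K : Type u} [Field K] {g : Type u} [LieRing g] [LieAlgebra K g]
    {M M' M'' : LieMod K g} (α : M →ₗ⁅K,g⁆ M') (β : M' →ₗ⁅K,g⁆ M'')
    (hα : Function.Injective α) (hαβ : Function.Exact α β) (hβ : Function.Surjective β) :
    -- the sets `Opext^n(g, N)`, `n ≥ 2`, are abelian groups under the Baer sum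
    (∀ (k : ℕ) (N : LieMod K g),
      (∀ x y z : Opext K g k N, x + y + z = x + (y + z)) ∧
      (∀ x y : Opext K g k N, x + y = y + x) ∧
      (∀ x : Opext K g k N, 0 + x = x) ∧
      (∀ x : Opext K g k N, -x + x = 0)) ∧
    -- the maps of the sequence are homomorphisms
    (∀ k : ℕ,
      (∀ x y, Opext.map k α (x + y) = Opext.map k α x + Opext.map k α y) ∧
      (∀ x y, Opext.map k β (x + y) = Opext.map k β x + Opext.map k β y) ∧
      (∀ x y, Opext.connecting k α β hα hαβ hβ (x + y) =
        Opext.connecting k α β hα hαβ hβ x + Opext.connecting k α β hα hαβ hβ y)) ∧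
    -- the sequence is exact
    (∀ k : ℕ,
      Function.Exact (Opext.map k α) (Opext.map k β) ∧
      Function.Exact (Opext.map k β) (Opext.connecting k α β hα hαβ hβ) ∧
      Function.Exact (Opext.connecting k α β hα hαβ hβ) (Opext.map (k + 1) α)) :=
  ⟨fun _ _ => ⟨Opext.add_assoc, Opext.add_comm, Opext.zero_add, Opext.neg_add_cancel⟩,
    fun _ => ⟨Opext.map_add α, Opext.map_add β, Opext.connecting_add α β hα hαβ hβ⟩,
    fun _ => ⟨Opext.exact_map_map α β hα hαβ hβ, Opext.exact_map_connecting α β hα hαβ hβ,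
      Opext.exact_connecting_map α β hα hαβ hβ⟩⟩
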